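/- Let $K$ be a field of characteristic $0$. For $d\geqslant 0$ let $\mathbb{L}_d=K((z_d))\cdots((z_1))$ be the field of iterated Laurent series, that is, the field of formal series $\sum_{n\in\mathbb{Z}^d}c_n z^n$ with $c_n \in K$ and with support well-ordered for the lexicographic order $<$ of $\mathbb{Z}^d$; it contains the field $K(z_1,\dots,z_d)$. An algebraic closure $\overline{\mathbb{L}_d}$ is realised inside the algebraically closed field of series with exponents in $\mathbb{Q}^d$ (lexicographically ordered, with well-ordered supports) and with coefficients in an algebraic closure of $K$. The leading monomial of a nonzero series is $\mathrm{lm}(\rho)=z^{v(\rho)}$, where $v(\rho)$ is the least element of the support of $\rho$, and monomials are ordered by $z^n\prec z^m \iff n>m$. Let $v$ be one more variable, inserted at an arbitrary position into the ordering $z_1\prec\dots\prec z_d$, and let $\mathbb{L}$ be the field of iterated Laurent series in these $d+1$ ordered variables; it contains $\mathbb{L}_d$ and $K(z_1,\dots,z_d)(v)$, and monomials in the $z_i$ are compared with $v$ in the order of the monomials in all $d+1$ variables. For $F\in\mathbb{L}$ let $\mathrm{res}_v F\in\mathbb{L}$ be the formal residue, i.e. the series that has the same coefficients as $vF$ at the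 monomials in which $v$ has exponent $0$, and coefficient $0$ at all other monomials. For $G\in K(z_1,\dots,z_d)(v)$ let $\mathrm{Res}_{v=0}G$ be the coefficient of $1/v$ in the Laurent expansion of $G$ at $v=0$, and let $$\mathrm{Res}_{v=\infty}G=\mathrm{Res}_{v=0}\Bigl(-\frac{1}{v^2}\,G|_{v\leftarrow 1/v}\Bigr).$$ Let $F=\sum_{k=1}^r a_k/f_k^{n_k}$, where the $a_k$ are polynomials in $K(z_1,\dots,z_d)[v]$, the $f_k$ are irreducible polynomials in $K(z_1,\dots,z_d)[v]$, and $n_k\in\mathbb{N}$. Call $\rho\in\overline{\mathbb{L}_d}$ small if $\rho=0$ or $\mathrm{lm}(\rho)\prec v$, and large otherwise. Suppose that for every $k$ there is $\varepsilon_k\in\{0,1\}$ such that all roots of $f_k$ in $\overline{\mathbb{L}_d}$ are small if $\varepsilon_k=1$, and all are large if $\varepsilon_k=0$. Then $$\mathrm{res}_v F=-\sum_{k=1}^r\varepsilon_k\,\mathrm{Res}_{v=\infty}\frac{a_k}{f_k^{n_k}}.$$ In particular, $\mathrm{res}_v F$ is a rational function, i.e. it lies in $K(z_1,\dots,z_d)\subseteq\mathbb{L}$.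 -/

import Mathlib

namespace GeomRed

/-- The field `𝕃_d = K((z_d))⋯((z_1))` of iterated Laurent series, as the field of Hahn series
over `ℤ^d` with the lexicographic order (the first coordinate is the most significant one):
functions `ℤ^d → K` whose support is well ordered. Index `0 : Fin d` is the variable `z_1`. -/
abbrev IterLaurent (K : Type*) [Field K] (d : ℕ) : Type _ := HahnSeries (Lex (Fin d → ℤ)) K

/-- Hahn series over `ℚ^d`, ordered lexicographically, with coefficients in an algebraic closure
of `K`. This is an algebraically closed field, and contains all iterated Puiseux series. -/
abbrev QSeries (K : Type*) [Field K] (d : ℕ) : Type _ :=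
  HahnSeries (Lex (Fin d → ℚ)) (AlgebraicClosure K)

/-- The field `K(z_1, …, z_d)` of rational functions. -/
abbrev RatField (K : Type*) [Field K] (d : ℕ) : Type _ := FractionRing (MvPolynomial (Fin d) K)

section Embeddings

variable {K : Type*} [Field K] {d : ℕ}

/-- The variable with index `i`, as an iterated Laurent series. -/
noncomputable def var (i : Fin d) : IterLaurent K d :=
  HahnSeries.single (toLex (Pi.single i (1 : ℤ))) 1

/-- Polynomials in the variables, as iterated Laurent series. -/
noncomputable def polyHom (K : Type*) [Field K] (d : ℕ) :
    MvPolynomial (Fin d) K →+* IterLaurent K d :=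
  MvPolynomial.eval₂Hom HahnSeries.C var

theorem prod_var_pow (n : Fin d →₀ ℕ) :
    (n.prod fun i k => (var i : IterLaurent K d) ^ k) =
      HahnSeries.single (toLex fun i => (n i : ℤ)) 1 := by
  induction n using Finsupp.induction_linear with
  | zero =>
    simp only [Finsupp.prod_zero_index]
    rfl
  | add f g hf hg =>
    rw [Finsupp.prod_add_index' (by simp) (by intros; exact pow_add _ _ _), hf, hg,
      HahnSeries.single_mul_single, one_mul]
    have h : (toLex (fun i => (f i : ℤ)) + toLex (fun i => (g i : ℤ)) : Lex (Fin d → ℤ)) =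
        toLex fun i => ((f + g) i : ℤ) := by
      apply toLex.symm.injective
      funext i
      exact (Nat.cast_add (f i) (g i)).symm
    rw [h]
  | single i k =>
    rw [Finsupp.prod_single_index (h := fun i k => (var i : IterLaurent K d) ^ k) (pow_zero _),
      var, HahnSeries.single_pow, one_pow]
    have h : k • (toLex (Pi.single i (1 : ℤ)) : Lex (Fin d → ℤ)) =
        toLex fun j => (Finsupp.single i k j : ℤ) := by
      apply toLex.symm.injective
      funext j
      change k • (Pi.single i (1 : ℤ) : Fin d → ℤ) j = (Finsupp.single i k j : ℤ)
      by_cases h : j = i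
      · subst h; simp
      · simp [h]
    rw [h]

theorem coeff_polyHom (P : MvPolynomial (Fin d) K) (n : Fin d →₀ ℕ) :
    (polyHom K d P).coeff (toLex fun i => (n i : ℤ)) = P.coeff n := by
  induction P using MvPolynomial.induction_on' with
  | monomial m c =>
    rw [polyHom, MvPolynomial.coe_eval₂Hom, MvPolynomial.eval₂_monomial, prod_var_pow,
      HahnSeries.C_mul_eq_smul, HahnSeries.coeff_smul, MvPolynomial.coeff_monomial]
    by_cases h : m = n
    · subst h; simp
    · rw [HahnSeries.coeff_single_of_ne, if_neg h, smul_zero]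
      intro h'
      apply h
      ext i
      have := congrFun (toLex.injective h') i
      simpa using this.symm
  | add p q hp hq => simp [hp, hq]

theorem polyHom_injective : Function.Injective (polyHom K d) := by
  intro P Q h
  ext n
  rw [← coeff_polyHom, ← coeff_polyHom, h]

/-- The inclusion `K(z_1, …, z_d) ⊆ 𝕃_d`. -/
noncomputable def ratHom (K : Type*) [Field K] (d : ℕ) : RatField K d →+* IterLaurent K d :=
  IsFractionRing.lift (polyHom_injective (K := K) (d := d))

/-- Exponents in the variables `z_1, …, z_d` seen as exponents in the `d + 1` variables obtained by
inserting one more variable at position `p`; the inserted variable gets exponent `0`. -/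
def insertExp {R : Type*} [AddCommMonoid R] (p : Fin (d + 1)) :
    Lex (Fin d → R) →+ Lex (Fin (d + 1) → R) where
  toFun e := toLex (p.insertNth (α := fun _ => R) 0 (ofLex e))
  map_zero' := by
    apply toLex.symm.injective
    funext j
    refine Fin.succAboveCases p ?_ (fun i => ?_) j <;> simp
  map_add' a b := by
    apply toLex.symm.injective
    funext j
    change p.insertNth (α := fun _ => R) 0 (ofLex a + ofLex b) j =
      p.insertNth (α := fun _ => R) 0 (ofLex a) j + p.insertNth (α := fun _ => R) 0 (ofLex b) j
    refine Fin.succAboveCases p ?_ (fun i => ?_) j <;> simp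

theorem insertExp_strictMono {R : Type*} [AddCommMonoid R] [LinearOrder R] (p : Fin (d + 1)) :
    StrictMono (insertExp (R := R) p : Lex (Fin d → R) → Lex (Fin (d + 1) → R)) := by
  rintro a b ⟨i, hi, hlt⟩
  refine ⟨p.succAbove i, fun j => ?_, ?_⟩
  · refine Fin.succAboveCases p (fun _ => ?_) (fun k hk => ?_) j
    · simp [insertExp]
    · have := hi k ((Fin.strictMono_succAbove p).lt_iff_lt.1 hk)
      simpa [insertExp] using this
  · simpa [insertExp] using hlt

/-- The inclusion of `𝕃_d` into the field of iterated Laurent series in `d + 1` variables, where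
the additional variable stands at position `p` of the ordering. -/
noncomputable def insertHom (K : Type*) [Field K] (p : Fin (d + 1)) :
    IterLaurent K d →+* IterLaurent K (d + 1) :=
  HahnSeries.embDomainRingHom (insertExp p) (insertExp_strictMono p).injective
    (fun _ _ => (insertExp_strictMono p).le_iff_le)

/-- Polynomials in `v` over `K(z_1, …, z_d)`, as iterated Laurent series in the `d + 1` variables
`v, z_1, …, z_d`, where `v` stands at position `p` of the ordering. -/
noncomputable def polyHomV (K : Type*) [Field K] (p : Fin (d + 1)) :
    Polynomial (RatField K d) →+* IterLaurent K (d + 1) :=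
  Polynomial.eval₂RingHom ((insertHom K p).comp (ratHom K d)) (var p)

theorem coeff_polyHomV (p : Fin (d + 1)) (P : Polynomial (RatField K d)) (m : ℕ)
    (e : Fin d → ℤ) :
    (polyHomV K p P).coeff (toLex (p.insertNth (α := fun _ => ℤ) (m : ℤ) e)) =
      (ratHom K d (P.coeff m)).coeff (toLex e) := by
  induction P using Polynomial.induction_on' with
  | add P Q hP hQ => simp [hP, hQ]
  | monomial k c =>
    have hk : (var p : IterLaurent K (d + 1)) ^ k =
        HahnSeries.single (toLex (Pi.single p (k : ℤ))) 1 := by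
      rw [var, HahnSeries.single_pow, one_pow]
      have h : k • (toLex (Pi.single p (1 : ℤ)) : Lex (Fin (d + 1) → ℤ)) =
          toLex (Pi.single p (k : ℤ)) := by
        apply toLex.symm.injective
        funext j
        change k • (Pi.single p (1 : ℤ) : Fin (d + 1) → ℤ) j = (Pi.single p (k : ℤ) : _ → ℤ) j
        by_cases h : j = p
        · subst h; simp
        · simp [h]
      rw [h]
    have he : toLex (p.insertNth (α := fun _ => ℤ) (m : ℤ) e) =
        toLex (p.insertNth (α := fun _ => ℤ) ((m : ℤ) - k) e) +
          toLex (Pi.single p (k : ℤ)) := by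
      apply toLex.symm.injective
      funext j
      change p.insertNth (α := fun _ => ℤ) (m : ℤ) e j =
        p.insertNth (α := fun _ => ℤ) ((m : ℤ) - k) e j + (Pi.single p (k : ℤ) : _ → ℤ) j
      refine Fin.succAboveCases p ?_ (fun i => ?_) j <;> simp
    rw [polyHomV, Polynomial.coe_eval₂RingHom, Polynomial.eval₂_monomial, hk, he,
      HahnSeries.coeff_mul_single_add, mul_one, Polynomial.coeff_monomial]
    by_cases h : k = m
    · subst h
      rw [if_pos rfl, sub_self]
      exact HahnSeries.embDomain_coeff
        (f := ⟨⟨insertExp p, (insertExp_strictMono p).injective⟩,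
          (insertExp_strictMono p).le_iff_le⟩) (a := toLex e)
    · rw [if_neg h, map_zero, HahnSeries.coeff_zero]
      apply HahnSeries.embDomain_of_notMem_range
      rintro ⟨a, ha⟩
      have := congrFun (toLex.injective ha) p
      simp at this
      omega

theorem polyHomV_injective (p : Fin (d + 1)) : Function.Injective (polyHomV K p) := by
  intro P Q h
  ext m
  apply (ratHom K d).injective
  ext e
  have := coeff_polyHomV p P m (ofLex e)
  rw [h, coeff_polyHomV] at this
  exact this.symm

/-- The inclusion of the field `K(z_1, …, z_d)(v)` of rational functions into the field of iterated
Laurent series in `v, z_1, …, z_d`, where `v` stands at position `p` of the ordering. -/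
noncomputable def ratFuncHom (K : Type*) [Field K] (p : Fin (d + 1)) :
    RatFunc (RatField K d) →+* IterLaurent K (d + 1) :=
  RatFunc.liftRingHom (polyHomV K p)
    (nonZeroDivisors_le_comap_nonZeroDivisors_of_injective _ (polyHomV_injective p))

/-- Exponents in `ℤ^d` as exponents in `ℚ^d`. -/
def castExp (d : ℕ) : Lex (Fin d → ℤ) →+ Lex (Fin d → ℚ) where
  toFun e := toLex fun i => (ofLex e i : ℚ)
  map_zero' := by
    apply toLex.symm.injective
    funext j
    exact Int.cast_zero
  map_add' a b := by
    apply toLex.symm.injective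
    funext j
    exact Int.cast_add _ _

theorem castExp_strictMono (d : ℕ) : StrictMono (castExp d) := by
  rintro a b ⟨i, hi, hlt⟩
  exact ⟨i, fun j hj => by simpa [castExp] using hi j hj, by simpa [castExp] using hlt⟩

/-- Extension of scalars to the algebraic closure of `K`, coefficient by coefficient. -/
noncomputable def mapCoeff (K : Type*) [Field K] (d : ℕ) :
    IterLaurent K d →+* HahnSeries (Lex (Fin d → ℤ)) (AlgebraicClosure K) where
  toFun f := f.map (algebraMap K (AlgebraicClosure K))
  map_zero' := by ext; simp
  map_one' := HahnSeries.map_one (algebraMap K (AlgebraicClosure K)).toMonoidWithZeroHom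
  map_add' _ _ := by ext; simp
  map_mul' _ _ := HahnSeries.map_mul
    ((algebraMap K (AlgebraicClosure K)) : K →ₙ+* AlgebraicClosure K)

/-- The inclusion of `𝕃_d` into the field of Hahn series with exponents in `ℚ^d`. -/
noncomputable def toQSeries (K : Type*) [Field K] (d : ℕ) : IterLaurent K d →+* QSeries K d :=
  (HahnSeries.embDomainRingHom (castExp d) (castExp_strictMono d).injective
    (fun _ _ => (castExp_strictMono d).le_iff_le)).comp (mapCoeff K d)

/-- The algebraic closure of `𝕃_d`: the elements of the algebraically closed field `QSeries K d`
that are algebraic over `𝕃_d`. -/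
noncomputable def algClosure (K : Type*) [Field K] (d : ℕ) : Subfield (QSeries K d) :=
  letI : Algebra (IterLaurent K d) (QSeries K d) := (toQSeries K d).toAlgebra
  (algebraicClosure (IterLaurent K d) (QSeries K d)).toSubfield

/-- `ρ` is a root of the polynomial `f ∈ K(z_1, …, z_d)[v]` in the algebraic closure of `𝕃_d`. -/
def IsRootOf (f : Polynomial (RatField K d)) (ρ : QSeries K d) : Prop :=
  ρ ∈ algClosure K d ∧ f.eval₂ ((toQSeries K d).comp (ratHom K d)) ρ = 0

/-- `ρ` is small: `ρ = 0` or `lm(ρ) ≺ v`, where `v` stands at position `p` of the ordering of the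
variables. The comparison is between monomials in `v, z_1, …, z_d` with rational exponents, and a
monomial is smaller when its exponent is lexicographically larger. `ρ.order` is the valuation of
`ρ`, that is, the least element of its support, which is the exponent of `lm(ρ)`. -/
def IsSmall (p : Fin (d + 1)) (ρ : QSeries K d) : Prop :=
  ρ = 0 ∨ toLex (Pi.single p (1 : ℚ)) < insertExp p ρ.order

/-- The formal residue of `f` with respect to the variable of index `i`: the series that retains
the coefficients of `z_i f` at the exponents `n` with `n_i = 0`. -/
noncomputable def formalRes (i : Fin d) (f : IterLaurent K d) : IterLaurent K d where
  coeff n := if ofLex n i = 0 then (var i * f).coeff n else 0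
  isPWO_support' := (var i * f).isPWO_support.mono fun n hn => by
    by_cases h : ofLex n i = 0
    · exact fun h' => hn ((if_pos h).trans h')
    · exact absurd (if_neg h) hn

end Embeddings

section ClassicalResidue

open scoped LaurentSeries

variable {A : Type*} [Field A]

/-- The classical residue at `v = 0` of a rational function `G ∈ A(v)`: the coefficient of `1 / v`
in its Laurent expansion at `0`, or equivalently in its partial fraction decomposition. -/
noncomputable def resZero (G : RatFunc A) : A :=
  (G : LaurentSeries A).coeff (-1)

/-- The residue at infinity of `G ∈ A(v)`, that is, `Res_{v = 0} (-(1 / v^2) G(1 / v))`. -/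
noncomputable def resInfty (G : RatFunc A) : A :=
  resZero (-(1 / RatFunc.X ^ 2) * RatFunc.eval RatFunc.C (1 / RatFunc.X) G)

end ClassicalResidue

end GeomRed

/-! Since the formal residue is additive, one fraction `a / f ^ n` may be treated at a time. Over
the algebraically closed field `QSeries K d`, f splits as c ∏ (v - ρ). If every ρ is small, each
factor is v (1 - ρ/v) with ρ/v of positive valuation, so f is c v^deg f times a series 1 + (positive
valuation). The geometric series then expands 1/f with only nonpositive exponents of v. If every ρ
is large, v - ρ = -ρ (1 - v/ρ), so f is f(0) times such a series and 1/f has only nonnegative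
exponents of v (`orderTop_polyHomV_div_pos_of_small`, `orderTop_polyHomV_div_pos_of_large`,
`inv_mem_supportedIn`).

In the large case `a / f ^ n` has no term in 1/v. In the small case its exponents in v are bounded
above. The equation f^n x = a is then a linear recurrence for the coefficients of the powers of v,
and its only solution bounded on that side is the expansion at v = ∞, whose coefficient of 1/v is
minus the residue at infinity (`eq_neg_resInfty_of_recurrence`).

The splitting rests on `isAlgClosed_hahnSeries`: a monic polynomial of degree at least 2 is shifted
and rescaled until its reduction has two coprime factors, and a Hensel lift over Hahn series
(`exists_mul_eq_of_coeff_zero_eq_mul`) makes it reducible. -/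

namespace GeomRed

open Polynomial

/-! ### Hensel lifting for Hahn series -/

section Hensel

variable {Γ R : Type*} [AddCommGroup Γ] [LinearOrder Γ] [IsOrderedAddMonoid Γ] [CommRing R]

/-- Both factors of the product formula can be summed over any partially well ordered set which
contains the supports. -/
theorem coeff_mul_of_support_subset {x y : HahnSeries Γ R} {s : Set Γ} (hs : s.IsPWO)
    (hx : x.support ⊆ s) (hy : y.support ⊆ s) (c : Γ) :
    (x * y).coeff c =
      ∑ ij ∈ Finset.antidiagonal hs hs c, x.coeff ij.1 * y.coeff ij.2 := by
  rw [HahnSeries.coeff_mul_left' hs hx]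
  refine Finset.sum_subset (fun ij h => ?_) (fun ij h h' => ?_)
  · rw [Finset.mem_antidiagonal] at h ⊢
    exact ⟨h.1, hy h.2.1, h.2.2⟩
  · rw [Finset.mem_antidiagonal] at h h'
    have : y.coeff ij.2 = 0 := by
      by_contra h0
      exact h' ⟨h.1, h0, h.2.2⟩
    rw [this, mul_zero]

/-- Lifting of a factorisation of the constant coefficient of a Hahn series, when the linearised
equation `g₀ w + h₀ u = r` can be solved with `u` and `w` in prescribed additive subgroups. -/
theorem exists_mul_eq_of_coeff_zero_eq_mul {x : HahnSeries Γ R} (hx : ∀ c < 0, x.coeff c = 0)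
    {g₀ h₀ : R} (h0 : x.coeff 0 = g₀ * h₀) (U V W : AddSubgroup R)
    (hUV : ∀ u ∈ U, ∀ w ∈ V, u * w ∈ W) (hxW : ∀ c, 0 < c → x.coeff c ∈ W)
    (hsolve : ∀ r ∈ W, ∃ u ∈ U, ∃ w ∈ V, g₀ * w + h₀ * u = r) :
    ∃ G H : HahnSeries Γ R, G * H = x ∧ G.coeff 0 = g₀ ∧ H.coeff 0 = h₀ ∧
      ∀ c ≠ 0, G.coeff c ∈ U ∧ H.coeff c ∈ V := by
  classical
  -- Both factors are sought with support in the monoid generated by the support of `x`. It is well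
  -- ordered because that support is nonnegative, so the coefficients can be defined by recursion on
  -- it.
  set S : AddSubmonoid Γ := AddSubmonoid.closure x.support with hS
  have hpos : ∀ c ∈ x.support, (0 : Γ) ≤ c := fun c hc => by
    by_contra hc'
    exact hc (hx c (not_le.1 hc'))
  have hSpos : ∀ c ∈ S, (0 : Γ) ≤ c := by
    intro c hc
    have : S ≤ AddSubmonoid.nonneg Γ := (AddSubmonoid.closure_le).2 hpos
    exact this hc
  have hPWO : (S : Set Γ).IsPWO := x.isPWO_support.addSubmonoid_closure hpos
  have wf : WellFounded (fun a b : S => a < b) := hPWO.isWF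
  choose! u hu w hw huw using hsolve
  -- At `c ≠ 0` the equation `G * H = x` reads g₀ w + h₀ u = r, where r subtracts from `x.coeff c`
  -- all products of coefficients at exponents below `c`.
  let step : ∀ c : S, (∀ b : S, b < c → R × R) → R × R := fun c rec =>
    if c = 0 then (g₀, h₀) else
      let r := x.coeff c - ∑ ij ∈ (Finset.antidiagonal hPWO hPWO (c : Γ)).attach,
        if h : ij.1.1 < c ∧ ij.1.2 < c then
          (rec ⟨ij.1.1, (Finset.mem_antidiagonal.1 ij.2).1⟩ h.1).1 *
            (rec ⟨ij.1.2, (Finset.mem_antidiagonal.1 ij.2).2.1⟩ h.2).2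
        else 0
      (u r, w r)
  let sol : S → R × R := wf.fix step
  have hsol : ∀ c, sol c = step c fun b _ => sol b := fun c => wf.fix_eq step c
  let Gf : Γ → R := fun c => if h : c ∈ S then (sol ⟨c, h⟩).1 else 0
  let Hf : Γ → R := fun c => if h : c ∈ S then (sol ⟨c, h⟩).2 else 0
  have hGf : Function.support Gf ⊆ S := fun c hc => by
    by_contra h
    exact hc (dif_neg h)
  have hHf : Function.support Hf ⊆ S := fun c hc => by
    by_contra h
    exact hc (dif_neg h)
  let rem : Γ → R := fun c => x.coeff c - ∑ ij ∈ Finset.antidiagonal hPWO hPWO c,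
        if ij.1 < c ∧ ij.2 < c then Gf ij.1 * Hf ij.2 else 0
  have hrec : ∀ c ∈ S, c ≠ 0 → Gf c = u (rem c) ∧ Hf c = w (rem c) := by
    intro c hc hc0
    have hr : sol ⟨c, hc⟩ = (u (rem c), w (rem c)) := by
      rw [hsol]
      have : (⟨c, hc⟩ : S) ≠ 0 := fun h => hc0 (congrArg Subtype.val h)
      simp only [step, if_neg this, rem]
      rw [← Finset.sum_attach (Finset.antidiagonal hPWO hPWO c)]
      have : ∀ ij ∈ (Finset.antidiagonal hPWO hPWO c).attach,
        (if h : ij.1.1 < c ∧ ij.1.2 < c then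
          (sol ⟨ij.1.1, (Finset.mem_antidiagonal.1 ij.2).1⟩).1 *
            (sol ⟨ij.1.2, (Finset.mem_antidiagonal.1 ij.2).2.1⟩).2
        else 0) = if ij.1.1 < c ∧ ij.1.2 < c then Gf ij.1.1 * Hf ij.1.2 else 0 := by
        intro ij _
        have h1 : ij.1.1 ∈ S := (Finset.mem_antidiagonal.1 ij.2).1
        have h2 : ij.1.2 ∈ S := (Finset.mem_antidiagonal.1 ij.2).2.1
        simp only [Gf, Hf, dif_pos h1, dif_pos h2]
        split_ifs <;> rfl
      rw [Finset.sum_congr rfl this]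
    simp only [Gf, Hf, dif_pos hc, hr, and_self]
  have hG0 : Gf 0 = g₀ := by
    simp only [Gf, dif_pos S.zero_mem]
    rw [hsol]
    exact congrArg Prod.fst (if_pos rfl)
  have hH0 : Hf 0 = h₀ := by
    simp only [Hf, dif_pos S.zero_mem]
    rw [hsol]
    exact congrArg Prod.snd (if_pos rfl)
  have hmem : ∀ c : S, (c : Γ) ≠ 0 → rem c ∈ W ∧ Gf c ∈ U ∧ Hf c ∈ V := by
    intro c
    induction c using wf.induction with
    | h c ih =>
      intro hc0
      have hrW : rem c ∈ W := by
        refine W.sub_mem (hxW _ (lt_of_le_of_ne (hSpos _ c.2) hc0.symm)) (W.sum_mem fun ij h => ?_)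
        obtain ⟨h1, h2, h3⟩ := Finset.mem_antidiagonal.1 h
        split_ifs with hlt
        · refine hUV _ (ih ⟨ij.1, h1⟩ hlt.1 ?_).2.1 _ (ih ⟨ij.2, h2⟩ hlt.2 ?_).2.2
          · rintro (h0 : ij.1 = 0)
            rw [h0, zero_add] at h3
            exact hlt.2.ne h3
          · rintro (h0 : ij.2 = 0)
            rw [h0, add_zero] at h3
            exact hlt.1.ne h3
        · exact W.zero_mem
      obtain ⟨e1, e2⟩ := hrec c c.2 hc0
      rw [e1, e2]
      exact ⟨hrW, hu _ hrW, hw _ hrW⟩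
  let G : HahnSeries Γ R := ⟨Gf, hPWO.mono hGf⟩
  let H : HahnSeries Γ R := ⟨Hf, hPWO.mono hHf⟩
  refine ⟨G, H, ?_, hG0, hH0, fun c hc => ?_⟩
  · ext c
    rw [coeff_mul_of_support_subset (x := G) (y := H) hPWO hGf hHf]
    change ∑ ij ∈ Finset.antidiagonal hPWO hPWO c, Gf ij.1 * Hf ij.2 = x.coeff c
    by_cases hc : c ∈ S
    · by_cases hc0 : c = 0
      · subst hc0
        have : Finset.antidiagonal hPWO hPWO (0 : Γ) = {(0, 0)} := by
          ext ⟨a, b⟩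
          rw [Finset.mem_antidiagonal, Finset.mem_singleton, Prod.mk.injEq]
          constructor
          · rintro ⟨h1, h2, h3⟩
            exact (add_eq_zero_iff_of_nonneg (hSpos _ h1) (hSpos _ h2)).1 h3
          · rintro ⟨rfl, rfl⟩
            exact ⟨S.zero_mem, S.zero_mem, add_zero _⟩
        rw [this, Finset.sum_singleton, hG0, hH0, h0]
      · obtain ⟨hr, -, -⟩ := hmem ⟨c, hc⟩ hc0
        obtain ⟨e1, e2⟩ := hrec c hc hc0
        have hcpos : 0 < c := lt_of_le_of_ne (hSpos _ hc) (Ne.symm hc0)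
        -- As `S` is nonnegative, the only decompositions of `c` without both parts below `c` are
        -- (0, c) and (c, 0); these carry the unknowns `u` and `w`.
        have key : ∑ ij ∈ Finset.antidiagonal hPWO hPWO c, Gf ij.1 * Hf ij.2 =
            (∑ ij ∈ Finset.antidiagonal hPWO hPWO c,
              if ij.1 < c ∧ ij.2 < c then Gf ij.1 * Hf ij.2 else 0) +
            ∑ ij ∈ {((0 : Γ), c), (c, (0 : Γ))}, Gf ij.1 * Hf ij.2 := by
          rw [← Finset.sum_filter, ← Finset.sum_filter_add_sum_filter_not
            (Finset.antidiagonal hPWO hPWO c) (fun ij => ij.1 < c ∧ ij.2 < c)]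
          congr 1
          refine Finset.sum_congr ?_ fun _ _ => rfl
          ext ⟨a, b⟩
          simp only [Finset.mem_filter, Finset.mem_antidiagonal, Finset.mem_insert,
            Finset.mem_singleton, Prod.mk.injEq, SetLike.mem_coe]
          constructor
          · rintro ⟨⟨ha, hb, rfl⟩, hn⟩
            by_contra hne
            push Not at hne
            have ha0 : 0 < a := lt_of_le_of_ne (hSpos _ ha) fun h => hne.1 h.symm (by simp [← h])
            have hb0 : 0 < b := lt_of_le_of_ne (hSpos _ hb) fun h => hne.2 (by simp [← h]) h.symm
            exact hn ⟨lt_add_of_pos_right _ hb0, lt_add_of_pos_left _ ha0⟩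
          · rintro (⟨rfl, rfl⟩ | ⟨rfl, rfl⟩)
            · exact ⟨⟨S.zero_mem, hc, zero_add _⟩, by simp⟩
            · exact ⟨⟨hc, S.zero_mem, add_zero _⟩, by simp⟩
        rw [key, Finset.sum_pair (by simp [Ne.symm hc0]), hG0, hH0, e1, e2, mul_comm _ h₀,
          huw _ hr, add_sub_cancel]
    · rw [show x.coeff c = 0 by
        by_contra h
        exact hc (AddSubmonoid.subset_closure h)]
      refine Finset.sum_eq_zero fun ij h => ?_
      obtain ⟨h1, h2, h3⟩ := Finset.mem_antidiagonal.1 h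
      exact absurd (h3 ▸ S.add_mem h1 h2) hc
  · change Gf c ∈ U ∧ Hf c ∈ V
    by_cases h : c ∈ S
    · exact (hmem ⟨c, h⟩ hc).2
    · simp only [Gf, Hf, dif_neg h]
      exact ⟨U.zero_mem, V.zero_mem⟩

end Hensel

/-! ### Polynomials over Hahn series as Hahn series of polynomials -/

section Swap

variable {Γ k : Type*} [AddCommGroup Γ] [LinearOrder Γ] [IsOrderedAddMonoid Γ] [Field k]

/-- Hahn series with coefficients in `k` as Hahn series with coefficients in `k[X]`. -/
noncomputable def mapPolyC (Γ k : Type*) [AddCommGroup Γ] [LinearOrder Γ] [IsOrderedAddMonoid Γ]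
    [Field k] : HahnSeries Γ k →+* HahnSeries Γ k[X] where
  toFun f := f.map (C : k →+* k[X])
  map_zero' := by ext; simp
  map_one' := HahnSeries.map_one (C : k →+* k[X]).toMonoidWithZeroHom
  map_add' _ _ := by ext; simp
  map_mul' _ _ := HahnSeries.map_mul ((C : k →+* k[X]) : k →ₙ+* k[X])

/-- Polynomials over Hahn series as Hahn series with polynomial coefficients. -/
noncomputable def polyToHahn (Γ k : Type*) [AddCommGroup Γ] [LinearOrder Γ] [IsOrderedAddMonoid Γ]
    [Field k] : (HahnSeries Γ k)[X] →+* HahnSeries Γ k[X] :=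
  eval₂RingHom (mapPolyC Γ k) (HahnSeries.C X)

theorem coeff_coeff_polyToHahn (P : (HahnSeries Γ k)[X]) (c : Γ) (i : ℕ) :
    ((polyToHahn Γ k P).coeff c).coeff i = (P.coeff i).coeff c := by
  induction P using Polynomial.induction_on' with
  | add P Q hP hQ => simp [hP, hQ]
  | monomial n f =>
    rw [polyToHahn, coe_eval₂RingHom, eval₂_monomial, ← map_pow, HahnSeries.C_apply,
      HahnSeries.coeff_mul_single_zero]
    change (C (f.coeff c) * X ^ n).coeff i = _
    rw [coeff_C_mul_X_pow, coeff_monomial]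
    by_cases h : i = n
    · simp [h]
    · rw [if_neg h, if_neg (Ne.symm h), HahnSeries.coeff_zero]

theorem polyToHahn_injective : Function.Injective (polyToHahn Γ k) := by
  intro P Q h
  ext i c
  rw [← coeff_coeff_polyToHahn, h, coeff_coeff_polyToHahn]

/-- The uniform degree bound leaves finitely many powers of `X`, and collecting the coefficients of
each one gives a Hahn series. The lifted factors are turned back into polynomials this way. -/
theorem exists_polyToHahn_eq {N : ℕ} {x : HahnSeries Γ k[X]} (hx : ∀ c, (x.coeff c).degree < N) :
    ∃ P, polyToHahn Γ k P = x := by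
  refine ⟨∑ i ∈ Finset.range N, monomial i (x.map (lcoeff k i).toAddMonoidHom), ?_⟩
  ext c i
  rw [coeff_coeff_polyToHahn, finsetSum_coeff]
  simp_rw [coeff_monomial]
  by_cases hi : i < N
  · rw [Finset.sum_eq_single i (fun j _ hj => if_neg hj)
      (fun h => absurd (Finset.mem_range.2 hi) h), if_pos rfl]
    rfl
  · rw [Finset.sum_eq_zero, HahnSeries.coeff_zero, coeff_eq_zero_of_degree_lt]
    · exact (hx c).trans_le (by exact_mod_cast not_lt.1 hi)
    · intro j hj
      refine if_neg ?_
      rintro rfl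
      exact hi (Finset.mem_range.1 hj)

/-- The Bézout equation of coprime polynomials with degree bounds. -/
theorem exists_mul_add_mul_eq_of_isCoprime {g h r : k[X]} (hg : g.Monic) (hgh : IsCoprime g h)
    (hr : r.degree < g.degree + h.degree) :
    ∃ u, u.degree < g.degree ∧ ∃ w, w.degree < h.degree ∧ g * w + h * u = r := by
  obtain ⟨a, b, hab⟩ := hgh
  -- The Bézout solution (a r, b r) is normalised by reducing b r modulo g and moving the quotient
  -- to the other unknown, whose degree is then bounded through g w = r - h u.
  refine ⟨(b * r) %ₘ g, degree_modByMonic_lt _ hg, a * r + h * ((b * r) /ₘ g), ?_, ?_⟩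
  · have hu := degree_modByMonic_lt (b * r) hg
    have e : g * (a * r + h * ((b * r) /ₘ g)) = r - h * ((b * r) %ₘ g) := by
      linear_combination r * hab + h * modByMonic_add_div (b * r) g
    have hlt : (g * (a * r + h * ((b * r) /ₘ g))).degree < g.degree + h.degree := by
      by_cases hh : h = 0
      · simp [hh] at hr
      rw [e]
      refine (degree_sub_le _ _).trans_lt (max_lt hr ?_)
      rw [degree_mul, add_comm]
      exact WithBot.add_lt_add_right (degree_ne_bot.2 hh) hu
    rw [degree_mul] at hlt
    exact lt_of_add_lt_add_left hlt
  · linear_combination r * hab + h * modByMonic_add_div (b * r) g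

/-- A monic polynomial with integral coefficients whose reduction is a product of two nonconstant
coprime monic polynomials is a product of two nonconstant polynomials. -/
theorem exists_eq_mul_of_reduction {P : (HahnSeries Γ k)[X]} (hP : P.Monic)
    (hint : ∀ i, ∀ c < 0, (P.coeff i).coeff c = 0) {g h : k[X]} (hg : g.Monic) (hh : h.Monic)
    (hgh : IsCoprime g h) (hred : ∀ i, (P.coeff i).coeff 0 = (g * h).coeff i)
    (hg0 : g.natDegree ≠ 0) (hh0 : h.natDegree ≠ 0) :
    ∃ A B, P = A * B ∧ A.natDegree ≠ 0 ∧ B.natDegree ≠ 0 := by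
  have hdeg : P.natDegree = g.natDegree + h.natDegree := by
    rw [← hg.natDegree_mul hh]
    refine le_antisymm ?_ ?_
    · by_contra hlt
      have h1 := hred P.natDegree
      rw [coeff_eq_zero_of_natDegree_lt (not_le.1 hlt), hP.coeff_natDegree] at h1
      simp at h1
    · by_contra hlt
      have h1 := hred (g * h).natDegree
      rw [coeff_eq_zero_of_natDegree_lt (not_le.1 hlt), (hg.mul hh).coeff_natDegree] at h1
      simp at h1
  have hgd := degree_eq_natDegree hg.ne_zero
  have hhd := degree_eq_natDegree hh.ne_zero
  -- The subgroups are the polynomials of degree below deg g, deg h and deg g + deg h. Monicity of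
  -- `P` puts its coefficients at positive exponents into the last one.
  obtain ⟨G, H, hGH, hG0, hH0, hmem⟩ := exists_mul_eq_of_coeff_zero_eq_mul
    (x := polyToHahn Γ k P) (g₀ := g) (h₀ := h)
    (fun c hc => by ext i; rw [coeff_coeff_polyToHahn, hint i c hc, coeff_zero])
    (by ext i; rw [coeff_coeff_polyToHahn, hred])
    (degreeLT k g.natDegree).toAddSubgroup (degreeLT k h.natDegree).toAddSubgroup
    (degreeLT k (g.natDegree + h.natDegree)).toAddSubgroup
    (by
      intro u hu w hw
      rw [Submodule.mem_toAddSubgroup, mem_degreeLT] at *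
      by_cases hw0 : w = 0
      · rw [hw0, mul_zero, degree_zero]
        exact WithBot.bot_lt_coe _
      · rw [degree_mul, Nat.cast_add]
        exact (WithBot.add_lt_add_right (degree_ne_bot.2 hw0) hu).trans_le
          (add_le_add le_rfl hw.le))
    (by
      intro c hc
      rw [Submodule.mem_toAddSubgroup, mem_degreeLT, ← hdeg, degree_lt_iff_coeff_zero]
      intro m hm
      rw [coeff_coeff_polyToHahn]
      rcases hm.lt_or_eq with hm | rfl
      · rw [coeff_eq_zero_of_natDegree_lt hm, HahnSeries.coeff_zero]
      · rw [hP.coeff_natDegree, HahnSeries.coeff_one, if_neg hc.ne'])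
    (by
      intro r hr
      rw [Submodule.mem_toAddSubgroup, mem_degreeLT, Nat.cast_add, ← hgd, ← hhd] at hr
      obtain ⟨u, hu, w, hw, e⟩ := exists_mul_add_mul_eq_of_isCoprime hg hgh hr
      exact ⟨u, mem_degreeLT.2 (hgd ▸ hu), w, mem_degreeLT.2 (hhd ▸ hw), e⟩)
  have key : ∀ (q : k[X]) (Q : HahnSeries Γ k[X]), q.Monic → Q.coeff 0 = q →
      (∀ c ≠ 0, Q.coeff c ∈ (degreeLT k q.natDegree).toAddSubgroup) →
      ∃ A, polyToHahn Γ k A = Q ∧ A.natDegree = q.natDegree := by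
    intro q Q hq hQ0 hQ
    have hlt : ∀ c, (Q.coeff c).degree < (q.natDegree + 1 : ℕ) := by
      intro c
      rw [← Order.succ_eq_add_one, degree_lt_iff_coeff_zero]
      intro m hm
      have hm' := Nat.lt_of_succ_le hm
      by_cases hc : c = 0
      · rw [hc, hQ0, coeff_eq_zero_of_natDegree_lt hm']
      · exact (degree_lt_iff_coeff_zero _ _).1 (mem_degreeLT.1 (hQ c hc)) m hm'.le
    obtain ⟨A, hA⟩ := exists_polyToHahn_eq hlt
    refine ⟨A, hA, le_antisymm ?_ ?_⟩
    · rw [natDegree_le_iff_coeff_eq_zero]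
      intro m hm
      ext c
      rw [← coeff_coeff_polyToHahn, hA, HahnSeries.coeff_zero]
      exact (degree_lt_iff_coeff_zero _ _).1 (hlt c) m hm
    · refine le_natDegree_of_ne_zero fun h0 => ?_
      have := coeff_coeff_polyToHahn A 0 q.natDegree
      rw [h0, hA, hQ0, hq.coeff_natDegree] at this
      simp at this
  obtain ⟨A, hA, hAd⟩ := key g G hg hG0 fun c hc => (hmem c hc).1
  obtain ⟨B, hB, hBd⟩ := key h H hh hH0 fun c hc => (hmem c hc).2
  exact ⟨A, B, polyToHahn_injective (by rw [map_mul, hA, hB, hGH]), hAd ▸ hg0, hBd ▸ hh0⟩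

end Swap

/-! ### Algebraic closedness of Hahn series fields -/

section AlgClosed

variable {Γ k : Type*} [AddCommGroup Γ] [LinearOrder Γ] [IsOrderedAddMonoid Γ] [Field k]

/-- A monic polynomial over an algebraically closed field of characteristic zero whose subleading
coefficient vanishes is a power of the variable or a product of two coprime monic polynomials. -/
theorem exists_isCoprime_mul_eq [IsAlgClosed k] [CharZero k] {q : k[X]} (hq : q.Monic)
    (hn : q.natDegree ≠ 0) (hsub : q.coeff (q.natDegree - 1) = 0) (hX : q ≠ X ^ q.natDegree) :
    ∃ g h : k[X], g.Monic ∧ h.Monic ∧ IsCoprime g h ∧ g * h = q ∧ g.natDegree ≠ 0 ∧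
      h.natDegree ≠ 0 := by
  obtain ⟨l, hl⟩ := IsAlgClosed.exists_root q (by
    rw [degree_eq_natDegree hq.ne_zero]
    exact_mod_cast hn)
  obtain ⟨h, e, hnd⟩ := exists_eq_pow_rootMultiplicity_mul_and_not_dvd q hq.ne_zero l
  have hm : q.rootMultiplicity l ≠ 0 := ((rootMultiplicity_pos hq.ne_zero).2 hl).ne'
  set m := q.rootMultiplicity l
  have hgm : ((X - C l) ^ m).Monic := (monic_X_sub_C l).pow m
  have hhm : h.Monic := hgm.of_mul_monic_left (e ▸ hq)
  refine ⟨(X - C l) ^ m, h, hgm, hhm, ?_, e.symm, ?_, fun hh => ?_⟩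
  · exact IsCoprime.pow_left (((irreducible_X_sub_C l).coprime_iff_not_dvd).2 hnd)
  · rwa [natDegree_pow, natDegree_X_sub_C, mul_one]
  -- Otherwise q = (X - l)^m with subleading coefficient -m l. Its vanishing forces l = 0 in
  -- characteristic zero, so q would be a power of `X`.
  · rw [hhm.natDegree_eq_zero.1 hh, mul_one] at e
    have hd : q.natDegree = m := by rw [e, natDegree_pow, natDegree_X_sub_C, mul_one]
    have hnext : q.nextCoeff = 0 := by rw [nextCoeff_of_natDegree_pos (Nat.pos_of_ne_zero hn), hsub]
    rw [e, (monic_X_sub_C l).nextCoeff_pow, nextCoeff_X_sub_C, smul_neg, neg_eq_zero,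
      nsmul_eq_mul, mul_eq_zero, Nat.cast_eq_zero] at hnext
    rcases hnext with h0 | h0
    · exact hm h0
    · rw [hd, e, h0, C_0, sub_zero] at hX
      exact hX rfl

/-- A Newton polygon argument: rescaling the variable by the least slope makes all coefficients
integral and keeps some non-leading coefficient nonzero in the reduction. With vanishing subleading
coefficient the reduction splits into coprime factors, which lift. -/
theorem exists_eq_mul_of_coeff_eq_zero [IsAlgClosed k] [CharZero k]
    (hdiv : ∀ (m : ℕ) (c : Γ), m ≠ 0 → ∃ b, m • b = c) {P : (HahnSeries Γ k)[X]} (hP : P.Monic)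
    (hn : 2 ≤ P.natDegree) (hsub : P.coeff (P.natDegree - 1) = 0) :
    ∃ A B, P = A * B ∧ A.natDegree ≠ 0 ∧ B.natDegree ≠ 0 := by
  set n := P.natDegree with hnd
  classical
  by_cases hX : ∀ i < n, P.coeff i = 0
  · refine ⟨X, X ^ (n - 1), ?_, by simp, by rw [natDegree_X_pow]; omega⟩
    rw [← pow_succ', Nat.sub_add_cancel (by omega)]
    ext1 i
    rw [coeff_X_pow]
    split_ifs with hi
    · rw [hi, hnd, hP.coeff_natDegree]
    · rcases lt_or_gt_of_ne hi with h | h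
      · exact hX i h
      · exact coeff_eq_zero_of_natDegree_lt h
  · push Not at hX
    choose! δ hδ using hdiv
    -- `δ m c` is a chosen quotient c / m, so i₀ minimises the slope ord(P_i) / (n - i) over the
    -- nonzero non-leading coefficients.
    obtain ⟨i₀, hi₀, hmin⟩ := Finset.exists_min_image
      ((Finset.range n).filter fun i => P.coeff i ≠ 0)
      (fun i => δ (n - i) (P.coeff i).order)
      (by
        obtain ⟨i, h1, h2⟩ := hX
        exact ⟨i, Finset.mem_filter.2 ⟨Finset.mem_range.2 h1, h2⟩⟩)
    rw [Finset.mem_filter, Finset.mem_range] at hi₀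
    set c₀ := δ (n - i₀) (P.coeff i₀).order with hc₀
    have hcoeff : ∀ i c, ((P.scaleRoots (HahnSeries.single (-c₀) 1)).coeff i).coeff c =
        (P.coeff i).coeff (c + (n - i) • c₀) := by
      intro i c
      rw [coeff_scaleRoots, HahnSeries.single_pow, one_pow, HahnSeries.coeff_mul_single, mul_one,
        smul_neg, sub_neg_eq_add]
    have hQ : (P.scaleRoots (HahnSeries.single (-c₀) 1)).Monic := (monic_scaleRoots_iff _).2 hP
    set Q := P.scaleRoots (HahnSeries.single (-c₀) 1) with hQdef
    have hQn : Q.natDegree = n := natDegree_scaleRoots _ _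
    set q := (polyToHahn Γ k Q).coeff 0 with hqdef
    have hqc : ∀ i, q.coeff i = (Q.coeff i).coeff 0 := fun i => coeff_coeff_polyToHahn Q 0 i
    have hqle : q.natDegree ≤ n := by
      rw [natDegree_le_iff_coeff_eq_zero]
      intro i hi
      rw [hqc, coeff_eq_zero_of_natDegree_lt (hQn ▸ hi), HahnSeries.coeff_zero]
    have hq1 : q.coeff n = 1 := by
      rw [hqc, ← hQn, hQ.coeff_natDegree, HahnSeries.coeff_one, if_pos rfl]
    have hqm : q.Monic := monic_of_natDegree_le_of_coeff_eq_one n hqle hq1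
    have hqn : q.natDegree = n :=
      le_antisymm hqle (le_natDegree_of_ne_zero (by rw [hq1]; exact one_ne_zero))
    obtain ⟨g, h, hg, hh, hgh, e, hg0, hh0⟩ := exists_isCoprime_mul_eq hqm (by omega)
      (by rw [hqn, hqc, hcoeff, hsub, HahnSeries.coeff_zero])
      -- The reduction is not X^n: its coefficient at i₀ is the leading coefficient of the series
      -- `P.coeff i₀`.
      (by
        intro h
        have h1 : q.coeff i₀ = 0 := by rw [h, coeff_X_pow, if_neg (by omega)]
        rw [hqc, hcoeff, zero_add, hc₀, hδ _ _ (by omega)] at h1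
        exact hi₀.2 (HahnSeries.coeff_order_eq_zero.1 h1))
    obtain ⟨A, B, hAB, hA, hB⟩ := exists_eq_mul_of_reduction hQ
      (by
        intro i c hc
        rw [hcoeff]
        by_cases hin : i < n
        · by_cases hi0 : P.coeff i = 0
          · rw [hi0, HahnSeries.coeff_zero]
          · apply HahnSeries.coeff_eq_zero_of_lt_order
            have := nsmul_le_nsmul_right (hmin i (Finset.mem_filter.2 ⟨Finset.mem_range.2 hin, hi0⟩))
              (n - i)
            simp only [hδ (n - i) _ (by omega)] at this
            exact (add_lt_of_neg_left _ hc).trans_le this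
        · rcases (not_lt.1 hin).lt_or_eq with h | h
          · rw [coeff_eq_zero_of_natDegree_lt h, HahnSeries.coeff_zero]
          · rw [← h, hnd, hP.coeff_natDegree, HahnSeries.coeff_one, if_neg]
            simpa using hc.ne)
      hg hh hgh (fun i => by rw [← hqc, e]) hg0 hh0
    refine ⟨A.scaleRoots (HahnSeries.single c₀ 1), B.scaleRoots (HahnSeries.single c₀ 1), ?_,
      by rwa [natDegree_scaleRoots], by rwa [natDegree_scaleRoots]⟩
    rw [← mul_scaleRoots_of_noZeroDivisors, ← hAB, hQdef, ← scaleRoots_mul,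
      HahnSeries.single_mul_single, neg_add_cancel, one_mul, HahnSeries.single_zero_one,
      scaleRoots_one]

/-- Hahn series with exponents in a divisible group and with coefficients in an algebraically
closed field of characteristic zero form an algebraically closed field. -/
theorem isAlgClosed_hahnSeries [IsAlgClosed k] [CharZero k]
    (hdiv : ∀ (m : ℕ) (c : Γ), m ≠ 0 → ∃ b, m • b = c) : IsAlgClosed (HahnSeries Γ k) := by
  have hchar : CharZero (HahnSeries Γ k) :=
    charZero_of_injective_ringHom (HahnSeries.C_injective (Γ := Γ) (R := k))
  refine IsAlgClosed.of_exists_root _ fun P hP hirr => ?_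
  rcases Nat.lt_or_ge P.natDegree 2 with hlt | hn
  · exact exists_root_of_degree_eq_one
      ((degree_eq_iff_natDegree_eq_of_pos one_pos).2 (by have := hirr.natDegree_pos; omega))
  · exfalso
    set n := P.natDegree with hnd
    -- The subleading coefficient of P(X + t) is P_{n-1} + n t, which this shift annihilates.
    set t : HahnSeries Γ k := -(P.coeff (n - 1)) / n with ht
    have hn0 : (n : HahnSeries Γ k) ≠ 0 := Nat.cast_ne_zero.2 (by omega)
    have hPn : (taylor t P).natDegree = n := natDegree_taylor P t
    obtain ⟨A, B, hAB, hA, hB⟩ := exists_eq_mul_of_coeff_eq_zero hdiv (P := taylor t P)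
      (by rw [Monic, leadingCoeff_taylor, hP.leadingCoeff]) (hPn ▸ hn)
      (by
        rw [hPn, taylor_coeff]
        have hd : (hasseDeriv (n - 1) P).natDegree ≤ 1 :=
          (natDegree_hasseDeriv_le P (n - 1)).trans (by omega)
        rw [eval_eq_sum_range' (Nat.lt_succ_of_le hd), Finset.sum_range_succ,
          Finset.sum_range_one, hasseDeriv_coeff, hasseDeriv_coeff, zero_add, Nat.choose_self,
          show 1 + (n - 1) = n by omega, Nat.choose_symm_of_eq_add (show n = (n - 1) + 1 by omega),
          Nat.choose_one_right, hnd, hP.coeff_natDegree, ← hnd, ht]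
        field_simp
        simp)
    have e : P = taylor (-t) A * taylor (-t) B := by
      rw [← taylor_mul, ← hAB, taylor_taylor, neg_add_cancel, taylor_zero]
    rcases hirr.isUnit_or_isUnit e with hu | hu
    · exact hA (natDegree_taylor A (-t) ▸ natDegree_eq_zero_of_isUnit hu)
    · exact hB (natDegree_taylor B (-t) ▸ natDegree_eq_zero_of_isUnit hu)

end AlgClosed

theorem isAlgClosed_qSeries (K : Type*) [Field K] [CharZero K] (d : ℕ) :
    IsAlgClosed (QSeries K d) := by
  have : CharZero (AlgebraicClosure K) :=
    charZero_of_injective_algebraMap (algebraMap K (AlgebraicClosure K)).injective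
  refine isAlgClosed_hahnSeries fun m c hm => ⟨toLex fun i => ofLex c i / m, ?_⟩
  apply ofLex.injective
  funext i
  change m • (ofLex c i / m) = ofLex c i
  rw [nsmul_eq_mul, mul_div_cancel₀ _ (Nat.cast_ne_zero.2 hm)]

/-! ### Series of the form 1 + (positive valuation) and support conditions -/

section Order

variable {Γ R : Type*} [AddCommGroup Γ] [LinearOrder Γ] [IsOrderedAddMonoid Γ]

theorem orderTop_pos_iff_coeff_eq_zero {Γ : Type*} [AddCommGroup Γ] [LinearOrder Γ]
    [Zero R] {x : HahnSeries Γ R} :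
    0 < x.orderTop ↔ ∀ c ≤ 0, x.coeff c = 0 := by
  constructor
  · intro h c hc
    exact HahnSeries.coeff_eq_zero_of_lt_orderTop (lt_of_le_of_lt (by exact_mod_cast hc) h)
  · intro h
    by_cases hx : x = 0
    · rw [hx, HahnSeries.orderTop_zero]
      exact WithTop.coe_lt_top 0
    · rw [HahnSeries.zero_lt_orderTop_iff hx]
      by_contra hc
      exact hx (HahnSeries.coeff_order_eq_zero.1 (h _ (not_lt.1 hc)))

/-- Induction on the identity ab - 1 = (a - 1)(b - 1) + (a - 1) + (b - 1). -/
theorem orderTop_multiset_prod_sub_one_pos [Field R] (s : Multiset (HahnSeries Γ R))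
    (hs : ∀ x ∈ s, 0 < (x - 1).orderTop) : 0 < (s.prod - 1).orderTop := by
  induction s using Multiset.induction_on with
  | empty => simp
  | cons a s ih =>
    have ha := hs a (Multiset.mem_cons_self a s)
    have hb := ih fun x hx => hs x (Multiset.mem_cons_of_mem hx)
    rw [Multiset.prod_cons, show a * s.prod - 1 =
      (a - 1) * (s.prod - 1) + ((a - 1) + (s.prod - 1)) by ring]
    refine lt_of_lt_of_le (lt_min ?_ ?_) HahnSeries.min_orderTop_le_orderTop_add
    · rw [HahnSeries.orderTop_mul]
      exact lt_of_lt_of_le ha (le_add_of_nonneg_right hb.le)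
    · exact lt_of_lt_of_le (lt_min ha hb) HahnSeries.min_orderTop_le_orderTop_add

/-- The subring of Hahn series with support in a given submonoid of exponents. -/
def supportedIn (R : Type*) [Field R] (H : AddSubmonoid Γ) : Subring (HahnSeries Γ R) where
  carrier := {x | x.support ⊆ H}
  zero_mem' := by simp
  one_mem' := by
    simp only [Set.mem_ofPred_eq, HahnSeries.support_one, Set.singleton_subset_iff]
    exact H.zero_mem
  add_mem' {x y} hx hy := (HahnSeries.support_add_subset x y).trans (Set.union_subset hx hy)
  neg_mem' {x} hx := by simpa only [Set.mem_ofPred_eq, HahnSeries.support_neg] using hx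
  mul_mem' {x y} hx hy := HahnSeries.support_mul_subset.trans (by
    rintro _ ⟨a, ha, b, hb, rfl⟩
    exact H.add_mem (hx ha) (hy hb))

theorem mem_supportedIn [Field R] {H : AddSubmonoid Γ} {x : HahnSeries Γ R} :
    x ∈ supportedIn R H ↔ x.support ⊆ H := Iff.rfl

theorem single_mem_supportedIn [Field R] {H : AddSubmonoid Γ} {c : Γ} (hc : c ∈ H) (r : R) :
    HahnSeries.single c r ∈ supportedIn R H :=
  HahnSeries.support_single_subset.trans (Set.singleton_subset_iff.2 hc)

/-- The inverse is the geometric series in 1 - x, and each power of 1 - x has its support in `H`. -/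
theorem inv_mem_supportedIn [Field R] {H : AddSubmonoid Γ} {x : HahnSeries Γ R}
    (hx : x ∈ supportedIn R H) (h1 : 0 < (x - 1).orderTop) : x⁻¹ ∈ supportedIn R H := by
  have h1' : 0 < (1 - x).orderTop := by rwa [← neg_sub, HahnSeries.orderTop_neg]
  have e := HahnSeries.SummableFamily.one_sub_self_mul_hsum_powers h1'
  rw [sub_sub_cancel] at e
  rw [inv_eq_of_mul_eq_one_right e, mem_supportedIn]
  refine HahnSeries.SummableFamily.support_hsum_subset.trans (Set.iUnion_subset fun n => ?_)
  rw [HahnSeries.SummableFamily.powers_of_orderTop_pos h1']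
  exact (supportedIn R H).pow_mem ((supportedIn R H).sub_mem (supportedIn R H).one_mem hx) n

end Order

/-! ### Dominant terms of polynomials with only small or only large roots -/

section Roots

variable {K : Type*} [Field K] {d : ℕ}

theorem insertExp_apply_self {R : Type*} [AddCommMonoid R] (p : Fin (d + 1))
    (e : Lex (Fin d → R)) : ofLex (insertExp p e) p = 0 := by
  simp [insertExp]

theorem castExp_insertExp (p : Fin (d + 1)) (e : Lex (Fin d → ℤ)) :
    castExp (d + 1) (insertExp p e) = insertExp p (castExp d e) := by
  apply ofLex.injective
  funext j
  refine Fin.succAboveCases p ?_ (fun i => ?_) j <;> simp [castExp, insertExp]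

/-- The inclusion of Hahn series with rational exponents in `d` variables into those in the `d + 1`
variables obtained by inserting one more variable at position `p`. -/
noncomputable def insertQ (K : Type*) [Field K] (p : Fin (d + 1)) :
    QSeries K d →+* QSeries K (d + 1) :=
  HahnSeries.embDomainRingHom (insertExp p) (insertExp_strictMono p).injective
    (fun _ _ => (insertExp_strictMono p).le_iff_le)

theorem insertHom_single (p : Fin (d + 1)) (e : Lex (Fin d → ℤ)) (c : K) :
    insertHom K p (HahnSeries.single e c) = HahnSeries.single (insertExp p e) c :=
  HahnSeries.embDomain_single

theorem insertQ_single (p : Fin (d + 1)) (e : Lex (Fin d → ℚ)) (c : AlgebraicClosure K) :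
    insertQ K p (HahnSeries.single e c) = HahnSeries.single (insertExp p e) c :=
  HahnSeries.embDomain_single

theorem toQSeries_single (e : Lex (Fin d → ℤ)) (c : K) :
    toQSeries K d (HahnSeries.single e c) =
      HahnSeries.single (castExp d e) (algebraMap K (AlgebraicClosure K) c) := by
  have h : mapCoeff K d (HahnSeries.single e c) =
      HahnSeries.single e (algebraMap K (AlgebraicClosure K) c) :=
    HahnSeries.map_single (algebraMap K (AlgebraicClosure K)).toZeroHom
  rw [toQSeries, RingHom.comp_apply, h]
  exact HahnSeries.embDomain_single

theorem coeff_toQSeries_castExp (x : IterLaurent K d) (e : Lex (Fin d → ℤ)) :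
    (toQSeries K d x).coeff (castExp d e) = algebraMap K (AlgebraicClosure K) (x.coeff e) :=
  HahnSeries.embDomain_coeff (f := ⟨⟨castExp d, (castExp_strictMono d).injective⟩,
    (castExp_strictMono d).le_iff_le⟩)

theorem orderTop_pos_of_toQSeries {x : IterLaurent K d} (h : 0 < (toQSeries K d x).orderTop) :
    0 < x.orderTop := by
  rw [orderTop_pos_iff_coeff_eq_zero] at h ⊢
  intro c hc
  have := h (castExp d c) (by rw [← map_zero (castExp d)]; exact (castExp_strictMono d).monotone hc)
  rwa [coeff_toQSeries_castExp, map_eq_zero] at this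

theorem ratHom_algebraMap (P : MvPolynomial (Fin d) K) :
    ratHom K d (algebraMap _ _ P) = polyHom K d P :=
  IsFractionRing.lift_algebraMap _ _

theorem toQSeries_insertHom_ratHom (p : Fin (d + 1)) :
    (toQSeries K (d + 1)).comp ((insertHom K p).comp (ratHom K d)) =
      (insertQ K p).comp ((toQSeries K d).comp (ratHom K d)) := by
  refine IsLocalization.ringHom_ext (nonZeroDivisors (MvPolynomial (Fin d) K)) ?_
  refine MvPolynomial.ringHom_ext (fun c => ?_) (fun i => ?_)
  · simp only [RingHom.comp_apply, ratHom_algebraMap, polyHom, MvPolynomial.coe_eval₂Hom,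
      MvPolynomial.eval₂_C, HahnSeries.C_apply, insertHom_single, insertQ_single,
      toQSeries_single, castExp_insertExp]
  · simp only [RingHom.comp_apply, ratHom_algebraMap, polyHom, MvPolynomial.coe_eval₂Hom,
      MvPolynomial.eval₂_X, var, insertHom_single, insertQ_single,
      toQSeries_single, castExp_insertExp]

/-- Algebraicity over 𝕃_d is automatic, as `f` itself is an annihilating polynomial. Hence every
root in `QSeries K d` falls under the hypothesis on roots. -/
theorem isRootOf_iff {f : (RatField K d)[X]} (hf : f ≠ 0) (ρ : QSeries K d) :
    IsRootOf f ρ ↔ f.eval₂ ((toQSeries K d).comp (ratHom K d)) ρ = 0 := by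
  refine ⟨fun h => h.2, fun h => ⟨?_, h⟩⟩
  let : Algebra (IterLaurent K d) (QSeries K d) := (toQSeries K d).toAlgebra
  change ρ ∈ (algebraicClosure (IterLaurent K d) (QSeries K d)).toSubfield
  rw [IntermediateField.mem_toSubfield, mem_algebraicClosure_iff]
  refine ⟨f.map (ratHom K d), (Polynomial.map_ne_zero_iff (ratHom K d).injective).2 hf, ?_⟩
  rw [aeval_def, eval₂_map]
  exact h

/-- The additional variable as a series with rational exponents. -/
noncomputable def varQ (K : Type*) [Field K] (p : Fin (d + 1)) : QSeries K (d + 1) :=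
  HahnSeries.single (toLex (Pi.single p (1 : ℚ))) 1

theorem toQSeries_var (p : Fin (d + 1)) : toQSeries K (d + 1) (var p) = varQ K p := by
  rw [var, toQSeries_single, map_one, varQ]
  suffices h : castExp (d + 1) (toLex (Pi.single p (1 : ℤ))) = toLex (Pi.single p (1 : ℚ)) by rw [h]
  apply ofLex.injective
  funext j
  by_cases h : j = p
  · subst h; simp [castExp]
  · simp [castExp, h]

theorem varQ_ne_zero (p : Fin (d + 1)) : varQ K p ≠ 0 := HahnSeries.single_ne_zero one_ne_zero

theorem order_varQ (p : Fin (d + 1)) : (varQ K p).order = toLex (Pi.single p (1 : ℚ)) :=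
  HahnSeries.order_single one_ne_zero

theorem order_insertQ (p : Fin (d + 1)) {ρ : QSeries K d} (hρ : ρ ≠ 0) :
    (insertQ K p ρ).order = insertExp p ρ.order := by
  have h : insertQ K p ρ ≠ 0 := (_root_.map_ne_zero _).2 hρ
  rw [← WithTop.coe_inj, HahnSeries.order_eq_orderTop_of_ne_zero h]
  refine (HahnSeries.orderTop_embDomain (f := ⟨⟨insertExp p, (insertExp_strictMono p).injective⟩,
    (insertExp_strictMono p).le_iff_le⟩)).trans ?_
  rw [← HahnSeries.order_eq_orderTop_of_ne_zero hρ]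
  rfl

theorem orderTop_div_pos {x y : QSeries K d} (hy : y ≠ 0) (h : x = 0 ∨ y.order < x.order) :
    0 < (x / y).orderTop := by
  by_cases hx : x = 0
  · rw [hx, zero_div, HahnSeries.orderTop_zero]
    exact WithTop.coe_lt_top 0
  · have hxy : x / y ≠ 0 := div_ne_zero hx hy
    have e : x.order = (x / y).order + y.order := by
      rw [← HahnSeries.order_mul hxy hy, div_mul_cancel₀ _ hy]
    rw [HahnSeries.zero_lt_orderTop_iff hxy]
    have := h.resolve_left hx
    rw [e] at this
    exact pos_of_lt_add_left this

theorem orderTop_varQ_sub_div_varQ (p : Fin (d + 1)) {ρ : QSeries K d} (h : IsSmall p ρ) :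
    0 < ((varQ K p - insertQ K p ρ) / varQ K p - 1).orderTop := by
  have h0 := varQ_ne_zero (K := K) p
  rw [sub_div, div_self h0, sub_sub_cancel_left, HahnSeries.orderTop_neg]
  refine orderTop_div_pos h0 ?_
  by_cases hρ : ρ = 0
  · exact Or.inl (by rw [hρ, map_zero])
  · rw [order_varQ, order_insertQ p hρ]
    exact Or.inr (h.resolve_left hρ)

theorem orderTop_varQ_sub_div_neg (p : Fin (d + 1)) {ρ : QSeries K d} (h : ¬ IsSmall p ρ) :
    0 < ((varQ K p - insertQ K p ρ) / (- insertQ K p ρ) - 1).orderTop := by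
  simp only [IsSmall, not_or] at h
  have h0 : insertQ K p ρ ≠ 0 := (_root_.map_ne_zero _).2 h.1
  have e : (varQ K p - insertQ K p ρ) / (- insertQ K p ρ) - 1 = -(varQ K p / insertQ K p ρ) := by
    field_simp
    ring
  rw [e, HahnSeries.orderTop_neg]
  refine orderTop_div_pos h0 (Or.inr ?_)
  rw [order_varQ, order_insertQ p h.1]
  -- Equality of the two monomials is impossible, since the exponent at `p` is 1 for v and 0 for ρ.
  refine lt_of_le_of_ne (not_lt.1 h.2) fun e => ?_
  have := congrFun (congrArg ofLex e) p
  rw [insertExp_apply_self] at this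
  simp at this

theorem toQSeries_polyHomV (p : Fin (d + 1)) (f : (RatField K d)[X]) :
    toQSeries K (d + 1) (polyHomV K p f) =
      ((f.map ((toQSeries K d).comp (ratHom K d))).map (insertQ K p)).eval (varQ K p) := by
  rw [polyHomV, coe_eval₂RingHom, hom_eval₂, toQSeries_insertHom_ratHom, toQSeries_var, map_map,
    eval_map]

theorem toQSeries_insertHom_ratHom_apply (p : Fin (d + 1)) (c : RatField K d) :
    toQSeries K (d + 1) (insertHom K p (ratHom K d c)) =
      insertQ K p (toQSeries K d (ratHom K d c)) :=
  RingHom.congr_fun (toQSeries_insertHom_ratHom p) c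

/-- If all roots of `f` are small, then its leading term dominates. -/
theorem orderTop_polyHomV_div_pos_of_small [CharZero K] (p : Fin (d + 1)) {f : (RatField K d)[X]}
    (hf : f ≠ 0) (h : ∀ ρ, IsRootOf f ρ → IsSmall p ρ) :
    0 < (polyHomV K p f / (insertHom K p (ratHom K d f.leadingCoeff) * var p ^ f.natDegree) -
      1).orderTop := by
  have := isAlgClosed_qSeries K d
  -- The roots exist only over `QSeries`, but the quotient is defined over `K` with integral
  -- exponents, so positivity of its valuation can be checked there.
  apply orderTop_pos_of_toQSeries
  rw [map_sub, map_one, map_div₀, map_mul, map_pow, toQSeries_polyHomV, toQSeries_var,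
    toQSeries_insertHom_ratHom_apply]
  set φ := (toQSeries K d).comp (ratHom K d) with hφ
  have hφf : f.map φ ≠ 0 := (Polynomial.map_ne_zero_iff φ.injective).2 hf
  have hs := IsAlgClosed.splits (f.map φ)
  have hc : insertQ K p (φ f.leadingCoeff) ≠ 0 := by
    rw [_root_.map_ne_zero, _root_.map_ne_zero]
    exact leadingCoeff_ne_zero.2 hf
  have hcard : (f.map φ).roots.card = f.natDegree := by
    rw [← hs.natDegree_eq_card_roots, natDegree_map]
  have e : ((f.map φ).map (insertQ K p)).eval (varQ K p) /
      (insertQ K p (φ f.leadingCoeff) * varQ K p ^ f.natDegree) =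
      ((f.map φ).roots.map fun ρ => (varQ K p - insertQ K p ρ) / varQ K p).prod := by
    rw [Multiset.prod_map_div, Multiset.map_const', Multiset.prod_replicate, hcard]
    conv_lhs => rw [hs.eq_prod_roots]
    rw [Polynomial.map_mul, map_C, eval_mul, eval_C, leadingCoeff_map,
      mul_div_mul_left _ _ hc, Polynomial.map_multiset_prod, eval_multiset_prod]
    simp only [Multiset.map_map, Function.comp_def, Polynomial.map_sub, map_X, map_C, eval_sub,
      eval_X, eval_C]
  change 0 < (_ / (insertQ K p (φ f.leadingCoeff) * _) - 1 : QSeries K (d + 1)).orderTop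
  rw [e]
  refine orderTop_multiset_prod_sub_one_pos _ fun x hx => ?_
  obtain ⟨ρ, hρ, rfl⟩ := Multiset.mem_map.1 hx
  refine orderTop_varQ_sub_div_varQ p (h ρ ((isRootOf_iff hf ρ).2 ?_))
  rw [← eval_map]
  exact (mem_roots hφf).1 hρ

/-- If all roots of `f` are large, then its constant term dominates. -/
theorem orderTop_polyHomV_div_pos_of_large [CharZero K] (p : Fin (d + 1)) {f : (RatField K d)[X]}
    (hf : f ≠ 0) (h : ∀ ρ, IsRootOf f ρ → ¬ IsSmall p ρ) :
    f.coeff 0 ≠ 0 ∧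
      0 < (polyHomV K p f / insertHom K p (ratHom K d (f.coeff 0)) - 1).orderTop := by
  have := isAlgClosed_qSeries K d
  have h0 : f.coeff 0 ≠ 0 := by
    intro h0
    refine h 0 ((isRootOf_iff hf 0).2 ?_) (Or.inl rfl)
    rw [eval₂_at_zero, h0, map_zero]
  refine ⟨h0, ?_⟩
  apply orderTop_pos_of_toQSeries
  rw [map_sub, map_one, map_div₀, toQSeries_polyHomV, toQSeries_insertHom_ratHom_apply]
  set φ := (toQSeries K d).comp (ratHom K d) with hφ
  have hφf : f.map φ ≠ 0 := (Polynomial.map_ne_zero_iff φ.injective).2 hf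
  have hs := IsAlgClosed.splits (f.map φ)
  have hc : insertQ K p (φ f.leadingCoeff) ≠ 0 := by
    rw [_root_.map_ne_zero, _root_.map_ne_zero]
    exact leadingCoeff_ne_zero.2 hf
  have ev : ∀ x, ((f.map φ).map (insertQ K p)).eval x = insertQ K p (φ f.leadingCoeff) *
      ((f.map φ).roots.map fun ρ => x - insertQ K p ρ).prod := by
    intro x
    conv_lhs => rw [hs.eq_prod_roots]
    rw [Polynomial.map_mul, map_C, eval_mul, eval_C, leadingCoeff_map,
      Polynomial.map_multiset_prod, eval_multiset_prod]
    simp only [Multiset.map_map, Function.comp_def, Polynomial.map_sub, map_X, map_C, eval_sub,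
      eval_X, eval_C]
  -- f(0) is the leading coefficient times ∏ (-ρ), so f / f(0) is the product of the factors (v - ρ)
  -- / (-ρ).
  have e0 : insertQ K p (φ (f.coeff 0)) = insertQ K p (φ f.leadingCoeff) *
      ((f.map φ).roots.map fun ρ => - insertQ K p ρ).prod := by
    have := ev 0
    simp only [zero_sub] at this
    rw [← this, ← coeff_zero_eq_eval_zero, coeff_map, coeff_map]
  change 0 < (_ / insertQ K p (φ (f.coeff 0)) - 1 : QSeries K (d + 1)).orderTop
  rw [e0, ev, mul_div_mul_left _ _ hc, ← Multiset.prod_map_div]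
  refine orderTop_multiset_prod_sub_one_pos _ fun x hx => ?_
  obtain ⟨ρ, hρ, rfl⟩ := Multiset.mem_map.1 hx
  refine orderTop_varQ_sub_div_neg p (h ρ ((isRootOf_iff hf ρ).2 ?_))
  rw [← eval_map]
  exact (mem_roots hφf).1 hρ

end Roots

/-! ### Coefficients of powers of v -/

section Slice

variable {K : Type*} [Field K] {d : ℕ}

/-- The exponent of the power `v ^ k` of the variable `v` at position `p`. -/
def axisExp (p : Fin (d + 1)) (k : ℤ) : Lex (Fin (d + 1) → ℤ) := toLex (Pi.single p k)

theorem axisExp_add (p : Fin (d + 1)) (k l : ℤ) :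
    axisExp p (k + l) = axisExp p k + axisExp p l := by
  apply ofLex.injective
  exact Pi.single_add (f := fun _ => ℤ) p k l

theorem axisExp_zero (p : Fin (d + 1)) : axisExp p 0 = 0 := by
  apply ofLex.injective
  exact Pi.single_zero (M := fun _ => ℤ) p

theorem axisExp_sub (p : Fin (d + 1)) (k l : ℤ) :
    axisExp p (k - l) = axisExp p k - axisExp p l := by
  rw [eq_sub_iff_add_eq, ← axisExp_add, sub_add_cancel]

theorem axisExp_apply_self (p : Fin (d + 1)) (k : ℤ) : ofLex (axisExp p k) p = k := by
  simp [axisExp]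

theorem exists_eq_insertExp_add_axisExp (p : Fin (d + 1)) (e : Lex (Fin (d + 1) → ℤ)) :
    ∃ b, e = insertExp p b + axisExp p (ofLex e p) := by
  refine ⟨toLex fun i => ofLex e (p.succAbove i), ?_⟩
  apply ofLex.injective
  funext j
  change ofLex e j = p.insertNth (α := fun _ => ℤ) 0 (fun i => ofLex e (p.succAbove i)) j +
    (Pi.single p (ofLex e p) : Fin (d + 1) → ℤ) j
  refine Fin.succAboveCases p ?_ (fun i => ?_) j <;> simp

/-- The integral powers of the additional variable. -/
noncomputable def varPow (K : Type*) [Field K] (p : Fin (d + 1)) (k : ℤ) : IterLaurent K (d + 1) :=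
  HahnSeries.single (axisExp p k) 1

theorem varPow_mul (p : Fin (d + 1)) (k l : ℤ) :
    varPow K p k * varPow K p l = varPow K p (k + l) := by
  rw [varPow, varPow, varPow, HahnSeries.single_mul_single, axisExp_add, one_mul]

theorem varPow_zero (p : Fin (d + 1)) : varPow K p 0 = 1 := by
  rw [varPow, axisExp_zero, HahnSeries.single_zero_one]

theorem varPow_ne_zero (p : Fin (d + 1)) (k : ℤ) : varPow K p k ≠ 0 :=
  HahnSeries.single_ne_zero one_ne_zero

theorem var_pow_eq_varPow (p : Fin (d + 1)) (i : ℕ) :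
    (var p : IterLaurent K (d + 1)) ^ i = varPow K p i := by
  induction i with
  | zero => rw [pow_zero, Nat.cast_zero, varPow_zero]
  | succ i ih =>
    rw [pow_succ, ih, Nat.cast_succ, ← varPow_mul]
    rfl

theorem coeff_insertHom_insertExp (p : Fin (d + 1)) (c : IterLaurent K d)
    (e : Lex (Fin d → ℤ)) : (insertHom K p c).coeff (insertExp p e) = c.coeff e :=
  HahnSeries.embDomain_coeff (f := ⟨⟨insertExp p, (insertExp_strictMono p).injective⟩,
    (insertExp_strictMono p).le_iff_le⟩)

theorem coeff_insertHom_of_ne_zero (p : Fin (d + 1)) (c : IterLaurent K d)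
    {e : Lex (Fin (d + 1) → ℤ)} (he : ofLex e p ≠ 0) : (insertHom K p c).coeff e = 0 := by
  apply HahnSeries.embDomain_of_notMem_range
  rintro ⟨a, rfl⟩
  exact he (insertExp_apply_self p a)

/-- The coefficient of the power `v ^ k` of the variable at position `p`. -/
noncomputable def slice (p : Fin (d + 1)) (k : ℤ) :
    IterLaurent K (d + 1) →+ IterLaurent K d where
  toFun x :=
    { coeff := fun e => x.coeff (insertExp p e + axisExp p k)
      isPWO_support' := by
        rw [Set.isPWO_iff_isWF]
        have hx := x.isWF_support
        let g : Function.support (fun e => x.coeff (insertExp p e + axisExp p k)) → x.support :=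
          fun e => ⟨insertExp p e.1 + axisExp p k, e.2⟩
        have h : WellFounded (InvImage (fun a b : x.support => a < b) g) := InvImage.wf g hx
        refine Subrelation.wf (fun {a b} hab => ?_) h
        exact add_lt_add_left (insertExp_strictMono p hab) _ }
  map_zero' := by ext; rfl
  map_add' x y := by ext; rfl

theorem coeff_slice (p : Fin (d + 1)) (k : ℤ) (x : IterLaurent K (d + 1)) (e : Lex (Fin d → ℤ)) :
    (slice p k x).coeff e = x.coeff (insertExp p e + axisExp p k) := rfl

theorem slice_eq_zero {p : Fin (d + 1)} {k : ℤ} {x : IterLaurent K (d + 1)}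
    (h : ∀ e ∈ x.support, ofLex e p ≠ k) : slice p k x = 0 := by
  ext e
  rw [coeff_slice, HahnSeries.coeff_zero]
  by_contra hne
  refine h _ hne ?_
  change ofLex (insertExp p e) p + ofLex (axisExp p k) p = k
  rw [insertExp_apply_self, axisExp_apply_self, zero_add]

theorem slice_varPow_mul (p : Fin (d + 1)) (k i : ℤ) (x : IterLaurent K (d + 1)) :
    slice p k (varPow K p i * x) = slice p (k - i) x := by
  ext e
  rw [coeff_slice, coeff_slice, varPow, HahnSeries.coeff_single_mul, one_mul, axisExp_sub,
    add_sub_assoc]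

theorem slice_insertHom (p : Fin (d + 1)) (k : ℤ) (c : IterLaurent K d) :
    slice p k (insertHom K p c) = if k = 0 then c else 0 := by
  split_ifs with hk
  · ext e
    rw [coeff_slice, hk, axisExp_zero, add_zero, coeff_insertHom_insertExp]
  · refine slice_eq_zero fun e he h => he (coeff_insertHom_of_ne_zero p c ?_)
    rwa [h]

/-- A factor free of v preserves exponents of v. Once the v^k layer of x is split off, the remainder
`y` contributes nothing to the slice. -/
theorem slice_insertHom_mul (p : Fin (d + 1)) (k : ℤ) (c : IterLaurent K d)
    (x : IterLaurent K (d + 1)) : slice p k (insertHom K p c * x) = c * slice p k x := by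
  set y := x - varPow K p k * insertHom K p (slice p k x) with hy
  have h1 : ∀ e ∈ y.support, ofLex e p ≠ k := by
    intro e he hek
    refine he ?_
    obtain ⟨b, hb⟩ := exists_eq_insertExp_add_axisExp p e
    rw [hek] at hb
    rw [hb, hy, HahnSeries.coeff_sub, varPow, HahnSeries.coeff_single_mul, one_mul,
      add_sub_cancel_right, coeff_insertHom_insertExp, coeff_slice, sub_self]
  have h2 : slice p k (insertHom K p c * y) = 0 := by
    refine slice_eq_zero fun e he hek => ?_
    obtain ⟨a, ha, b, hb, rfl⟩ := HahnSeries.support_mul_subset he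
    have ha0 : ofLex a p = 0 := by
      by_contra h
      exact ha (coeff_insertHom_of_ne_zero p c h)
    refine h1 b hb ?_
    rw [← hek]
    change ofLex b p = ofLex a p + ofLex b p
    rw [ha0, zero_add]
  have h3 : insertHom K p c * x =
      insertHom K p c * y + varPow K p k * insertHom K p (c * slice p k x) := by
    rw [hy, map_mul]
    ring
  rw [h3, map_add, h2, zero_add, slice_varPow_mul, sub_self, slice_insertHom, if_pos rfl]

theorem polyHomV_eq_sum (p : Fin (d + 1)) (g : (RatField K d)[X]) :
    polyHomV K p g = ∑ i ∈ Finset.range (g.natDegree + 1),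
      insertHom K p (ratHom K d (g.coeff i)) * varPow K p i := by
  rw [polyHomV, coe_eval₂RingHom, eval₂_eq_sum_range]
  exact Finset.sum_congr rfl fun i _ => by rw [var_pow_eq_varPow, RingHom.comp_apply]

theorem slice_polyHomV_mul (p : Fin (d + 1)) (k : ℤ) (g : (RatField K d)[X])
    (x : IterLaurent K (d + 1)) :
    slice p k (polyHomV K p g * x) = ∑ i ∈ Finset.range (g.natDegree + 1),
      ratHom K d (g.coeff i) * slice p (k - i) x := by
  rw [polyHomV_eq_sum, Finset.sum_mul, map_sum]
  exact Finset.sum_congr rfl fun i _ => by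
    rw [mul_assoc, slice_insertHom_mul, slice_varPow_mul]

/-- Multiplication by v moves the layer of v^(-1) to exponent 0, so the formal residue is that
coefficient, seen in d + 1 variables. -/
theorem formalRes_eq_insertHom_slice (p : Fin (d + 1)) (x : IterLaurent K (d + 1)) :
    formalRes p x = insertHom K p (slice p (-1) x) := by
  ext e
  change (if ofLex e p = 0 then (var p * x).coeff e else 0) = _
  split_ifs with h
  · obtain ⟨b, hb⟩ := exists_eq_insertExp_add_axisExp p e
    rw [h, axisExp_zero, add_zero] at hb
    rw [hb, coeff_insertHom_insertExp, coeff_slice, var, HahnSeries.coeff_single_mul, one_mul,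
      sub_eq_add_neg]
    congr 2
    rw [neg_eq_iff_add_eq_zero]
    change axisExp p 1 + axisExp p (-1) = 0
    rw [← axisExp_add, add_neg_cancel, axisExp_zero]
  · rw [coeff_insertHom_of_ne_zero p _ h]

end Slice

/-! ### Half-space supports of the inverses -/

section Support

variable {K : Type*} [Field K] {d : ℕ}

/-- The exponents whose entry at position `p` is zero or has the sign of `s`. -/
def halfSpace (p : Fin (d + 1)) (s : ℤ) : AddSubmonoid (Lex (Fin (d + 1) → ℤ)) where
  carrier := {e | 0 ≤ s * ofLex e p}
  zero_mem' := by
    change 0 ≤ s * 0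
    rw [mul_zero]
  add_mem' {a b} ha hb := by
    change 0 ≤ s * (ofLex a p + ofLex b p)
    rw [mul_add]
    exact add_nonneg ha hb

theorem varPow_mem_supportedIn {p : Fin (d + 1)} {s k : ℤ} (h : 0 ≤ s * k) :
    varPow K p k ∈ supportedIn K (halfSpace p s) := by
  refine single_mem_supportedIn ?_ 1
  change 0 ≤ s * ofLex (axisExp p k) p
  rwa [axisExp_apply_self]

theorem insertHom_mem_supportedIn (p : Fin (d + 1)) (s : ℤ) (c : IterLaurent K d) :
    insertHom K p c ∈ supportedIn K (halfSpace p s) := by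
  intro e he
  have h : ofLex e p = 0 := by
    by_contra h
    exact he (coeff_insertHom_of_ne_zero p c h)
  change 0 ≤ s * ofLex e p
  rw [h, mul_zero]

theorem polyHomV_mem_supportedIn (p : Fin (d + 1)) (g : (RatField K d)[X]) :
    polyHomV K p g ∈ supportedIn K (halfSpace p 1) := by
  rw [polyHomV_eq_sum]
  exact Subring.sum_mem _ fun i _ => Subring.mul_mem _ (insertHom_mem_supportedIn _ _ _)
    (varPow_mem_supportedIn (by omega))

theorem polyHomV_mul_varPow_mem_supportedIn (p : Fin (d + 1)) (g : (RatField K d)[X]) :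
    polyHomV K p g * varPow K p (-g.natDegree) ∈ supportedIn K (halfSpace p (-1)) := by
  rw [polyHomV_eq_sum, Finset.sum_mul]
  refine Subring.sum_mem _ fun i hi => ?_
  rw [mul_assoc, varPow_mul]
  refine Subring.mul_mem _ (insertHom_mem_supportedIn _ _ _) (varPow_mem_supportedIn ?_)
  have := Finset.mem_range.1 hi
  omega

/-- f / f(0) is 1 + (positive valuation) without negative powers of v, so the geometric series
applies within the half-space. -/
theorem inv_polyHomV_mem_supportedIn_of_large [CharZero K] (p : Fin (d + 1))
    {f : (RatField K d)[X]} (hf : f ≠ 0) (h : ∀ ρ, IsRootOf f ρ → ¬ IsSmall p ρ) :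
    (polyHomV K p f)⁻¹ ∈ supportedIn K (halfSpace p 1) := by
  obtain ⟨h0, hpos⟩ := orderTop_polyHomV_div_pos_of_large p hf h
  rw [div_eq_mul_inv, ← map_inv₀, ← map_inv₀] at hpos
  have := inv_mem_supportedIn (Subring.mul_mem _ (polyHomV_mem_supportedIn p f)
    (insertHom_mem_supportedIn p 1 _)) hpos
  have h1 : insertHom K p (ratHom K d (f.coeff 0)⁻¹) ≠ 0 := by
    simpa only [ne_eq, map_eq_zero, inv_eq_zero] using h0
  rw [mul_inv] at this
  have := Subring.mul_mem _ this (insertHom_mem_supportedIn p 1 (ratHom K d (f.coeff 0)⁻¹))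
  rwa [inv_mul_cancel_right₀ h1] at this

/-- The same argument for f divided by its leading term, which has no positive powers of v. -/
theorem inv_polyHomV_mem_supportedIn_of_small [CharZero K] (p : Fin (d + 1))
    {f : (RatField K d)[X]} (hf : f ≠ 0) (h : ∀ ρ, IsRootOf f ρ → IsSmall p ρ) :
    (polyHomV K p f)⁻¹ ∈ supportedIn K (halfSpace p (-1)) := by
  have hpos := orderTop_polyHomV_div_pos_of_small p hf h
  have hv : (varPow K p f.natDegree)⁻¹ = varPow K p (-f.natDegree) := by
    refine inv_eq_of_mul_eq_one_right ?_
    rw [varPow_mul, add_neg_cancel, varPow_zero]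
  rw [div_eq_mul_inv, mul_inv, ← map_inv₀, ← map_inv₀, var_pow_eq_varPow, hv,
    mul_comm (insertHom _ _ _), ← mul_assoc] at hpos
  have hmem := inv_mem_supportedIn (Subring.mul_mem _ (polyHomV_mul_varPow_mem_supportedIn p f)
    (insertHom_mem_supportedIn p (-1) _)) hpos
  have h1 : insertHom K p (ratHom K d f.leadingCoeff⁻¹) ≠ 0 := by
    simpa only [ne_eq, map_eq_zero, inv_eq_zero] using leadingCoeff_ne_zero.2 hf
  have := Subring.mul_mem _ hmem (Subring.mul_mem _
    (insertHom_mem_supportedIn p (-1) (ratHom K d f.leadingCoeff⁻¹))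
    (varPow_mem_supportedIn (k := -f.natDegree) (by omega)))
  have e : ∀ a b c : IterLaurent K (d + 1), b ≠ 0 → c ≠ 0 → (a * b * c)⁻¹ * (c * b) = a⁻¹ := by
    intro a b c hb hc
    rw [mul_inv, mul_inv]
    field_simp
  rwa [e _ _ _ (varPow_ne_zero _ _) h1] at this

end Support

/-! ### Residue at infinity through linear recurrences -/

section Infinity

open scoped LaurentSeries

variable {A : Type*} [Field A]

/-- A sequence which vanishes far to the left and satisfies a linear recurrence is zero. -/
theorem eq_zero_of_recurrence {g : A[X]} (hg : g ≠ 0) {u : ℤ → A} {N : ℤ}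
    (hN : ∀ j < N, u j = 0)
    (hu : ∀ j, ∑ i ∈ Finset.range (g.natDegree + 1), g.coeff i * u (j + i) = 0) (j : ℤ) :
    u j = 0 := by
  have key : ∀ m : ℕ, ∀ j < N + m, u j = 0 := by
    intro m
    induction m with
    | zero => intro j hj; exact hN j (by omega)
    | succ m ih =>
      intro j hj
      rcases lt_or_ge j (N + m) with h | h
      · exact ih j h
      -- At this index the term with the leading coefficient involves u j, and all the others vanish
      -- by induction.
      · have e := hu (j - g.natDegree)
        rw [Finset.sum_range_succ, Finset.sum_eq_zero, zero_add, sub_add_cancel] at e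
        · exact (mul_eq_zero.1 e).resolve_left (leadingCoeff_ne_zero.2 hg)
        · intro i hi
          rw [ih _ (by have := Finset.mem_range.1 hi; omega), mul_zero]
  exact key (j - N + 1).toNat j (by omega)

/-- Multiplication by a polynomial in `1 / X`, coefficient by coefficient. -/
theorem coeff_eval₂_inv_X_mul (g : A[X]) (y : LaurentSeries A) (j : ℤ) :
    (((g.eval₂ RatFunc.C (1 / RatFunc.X) : RatFunc A) : LaurentSeries A) * y).coeff j =
      ∑ i ∈ Finset.range (g.natDegree + 1), g.coeff i * y.coeff (j + i) := by
  have hX : ((1 / RatFunc.X : RatFunc A) : LaurentSeries A) = HahnSeries.single (-1) 1 := by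
    rw [map_div₀, map_one, RatFunc.coe_X, one_div, HahnSeries.inv_single, inv_one]
  have hC : ∀ a : A, ((RatFunc.C a : RatFunc A) : LaurentSeries A) = HahnSeries.C a := by
    intro a
    rw [← RatFunc.algebraMap_C, ← IsScalarTower.algebraMap_apply A[X] (RatFunc A)]
    simp
  rw [eval₂_eq_sum_range, map_sum, Finset.sum_mul, HahnSeries.coeff_sum]
  refine Finset.sum_congr rfl fun i _ => ?_
  rw [map_mul, map_pow, hX, hC, HahnSeries.single_pow, one_pow, HahnSeries.C_apply,
    HahnSeries.single_mul_single, mul_one, zero_add, HahnSeries.coeff_single_mul]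
  simp

theorem eval₂_inv_X_ne_zero {g : A[X]} (hg : g ≠ 0) :
    g.eval₂ RatFunc.C (1 / RatFunc.X) ≠ (0 : RatFunc A) := by
  intro h
  apply hg
  ext i
  have e := coeff_eval₂_inv_X_mul g 1 (-i)
  rw [h, map_zero, zero_mul, HahnSeries.coeff_zero] at e
  rw [coeff_zero]
  by_cases hi : i < g.natDegree + 1
  · rw [Finset.sum_eq_single i, HahnSeries.coeff_one, if_pos (by omega), mul_one] at e
    · exact e.symm
    · intro k _ hk
      rw [HahnSeries.coeff_one, if_neg (by omega), mul_zero]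
    · exact fun h => absurd (Finset.mem_range.2 hi) h
  · exact coeff_eq_zero_of_natDegree_lt (by omega)

/-- `RatFunc.eval` is multiplicative only where denominators do not vanish; at 1 / X none does. -/
theorem eval₂_inv_X_mul_eval_div (a : A[X]) {g : A[X]} (hg : g ≠ 0) :
    g.eval₂ RatFunc.C (1 / RatFunc.X) * RatFunc.eval RatFunc.C (1 / RatFunc.X)
      (algebraMap _ (RatFunc A) a / algebraMap _ (RatFunc A) g) =
      a.eval₂ RatFunc.C (1 / RatFunc.X) := by
  have h := RatFunc.eval_mul (f := RatFunc.C) (a := (1 / RatFunc.X : RatFunc A))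
    (x := algebraMap A[X] (RatFunc A) g)
    (y := algebraMap _ (RatFunc A) a / algebraMap _ (RatFunc A) g)
    (eval₂_inv_X_ne_zero (RatFunc.denom_ne_zero _)) (eval₂_inv_X_ne_zero (RatFunc.denom_ne_zero _))
  rw [mul_div_cancel₀ _ (RatFunc.algebraMap_ne_zero hg), RatFunc.eval_algebraMap,
    RatFunc.eval_algebraMap] at h
  exact h.symm

/-- The factor -1/X² shifts exponents by -2, so the coefficient at -1 comes from the one at 1. -/
theorem resInfty_eq_neg_coeff (G : RatFunc A) :
    resInfty G = -((RatFunc.eval RatFunc.C (1 / RatFunc.X) G : RatFunc A) :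
      LaurentSeries A).coeff 1 := by
  rw [resInfty, resZero, map_mul, map_neg, map_div₀, map_one, map_pow, RatFunc.coe_X,
    HahnSeries.single_pow, one_pow, one_div, HahnSeries.inv_single, inv_one, neg_mul,
    HahnSeries.coeff_neg, HahnSeries.coeff_single_mul, one_mul]
  simp

/-- A sequence which vanishes far to the left and satisfies the linear recurrence of the expansion
of `a / g` at infinity has the opposite of the residue at infinity as its entry at `1`. -/
theorem eq_neg_resInfty_of_recurrence {B : Type*} [Field B] (φ : A →+* B) (a : A[X]) {g : A[X]}
    (hg : g ≠ 0) {t : ℤ → B} {N : ℤ} (hN : ∀ j < N, t j = 0)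
    (ht : ∀ j, ∑ i ∈ Finset.range (g.natDegree + 1), φ (g.coeff i) * t (j + i) =
      ∑ i ∈ Finset.range (a.natDegree + 1), φ (a.coeff i) * if j + i = 0 then 1 else 0) :
    t 1 = φ (-resInfty (algebraMap _ (RatFunc A) a / algebraMap _ (RatFunc A) g)) := by
  rw [resInfty_eq_neg_coeff, neg_neg]
  have hy := congrArg (fun z : RatFunc A => (z : LaurentSeries A)) (eval₂_inv_X_mul_eval_div a hg)
  simp only [map_mul] at hy
  set y : LaurentSeries A := ((RatFunc.eval RatFunc.C (1 / RatFunc.X)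
    (algebraMap _ (RatFunc A) a / algebraMap _ (RatFunc A) g) : RatFunc A) : LaurentSeries A)
  rw [← sub_eq_zero]
  -- `t` and the coefficients of the expansion of (a/g)(1/X) satisfy the same recurrence; their
  -- difference solves the homogeneous one.
  refine eq_zero_of_recurrence (g := g.map φ) ((Polynomial.map_ne_zero_iff φ.injective).2 hg)
    (u := fun j => t j - φ (y.coeff j)) (N := min N y.order) ?_ ?_ 1
  · intro j hj
    rw [hN _ (hj.trans_le (min_le_left _ _)),
      HahnSeries.coeff_eq_zero_of_lt_order (hj.trans_le (min_le_right _ _)), map_zero, sub_zero]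
  · intro j
    have e := congrArg φ (coeff_eval₂_inv_X_mul g y j)
    rw [hy, ← mul_one ((a.eval₂ RatFunc.C (1 / RatFunc.X) : RatFunc A) : LaurentSeries A),
      coeff_eval₂_inv_X_mul, map_sum, map_sum] at e
    simp only [natDegree_map, coeff_map, mul_sub, Finset.sum_sub_distrib]
    rw [ht, sub_eq_zero]
    simp only [map_mul, HahnSeries.coeff_one, apply_ite φ, map_one, map_zero] at e
    exact e

end Infinity

/-! ### The residue of a single fraction -/

section Residue

variable {K : Type*} [Field K] {d : ℕ}

theorem slice_one (p : Fin (d + 1)) (k : ℤ) :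
    slice p k (1 : IterLaurent K (d + 1)) = if k = 0 then 1 else 0 := by
  rw [← map_one (insertHom K p), slice_insertHom]

/-- If the series `x` represents `a / g` and its exponents in `v` are bounded above, then it is the
expansion of `a / g` at infinity, and its residue is the opposite of the residue at infinity. -/
theorem slice_neg_one_eq_neg_resInfty (p : Fin (d + 1)) (a : (RatField K d)[X])
    {g : (RatField K d)[X]} (hg : g ≠ 0) {x : IterLaurent K (d + 1)}
    (hx : polyHomV K p g * x = polyHomV K p a) {N : ℤ} (hN : ∀ k > N, slice p k x = 0) :
    slice p (-1) x = ratHom K d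
      (-resInfty (algebraMap _ (RatFunc (RatField K d)) a / algebraMap _ _ g)) := by
  -- The substitution v = 1/X reverses indices: exponents bounded above become a sequence vanishing
  -- far to the left, and v^(-1) becomes the entry at 1.
  refine eq_neg_resInfty_of_recurrence (ratHom K d) a hg (t := fun j => slice p (-j) x) (N := -N)
    (fun j hj => hN _ (by omega)) fun j => ?_
  have e := slice_polyHomV_mul p (-j) g x
  rw [hx, ← mul_one (polyHomV K p a), slice_polyHomV_mul] at e
  simp only [neg_add']
  rw [← e]
  refine Finset.sum_congr rfl fun i _ => ?_
  rw [slice_one]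
  congr 1
  exact if_congr (by omega) rfl rfl

theorem ratFuncHom_algebraMap (p : Fin (d + 1)) (g : (RatField K d)[X]) :
    ratFuncHom K p (algebraMap _ _ g) = polyHomV K p g := by
  rw [ratFuncHom, RatFunc.liftRingHom_algebraMap]

theorem formalRes_div_pow_of_large [CharZero K] (p : Fin (d + 1)) (a : (RatField K d)[X])
    {f : (RatField K d)[X]} (hf : f ≠ 0) (n : ℕ) (h : ∀ ρ, IsRootOf f ρ → ¬ IsSmall p ρ) :
    formalRes p (ratFuncHom K p (algebraMap _ _ a / algebraMap _ _ f ^ n)) = 0 := by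
  rw [formalRes_eq_insertHom_slice, map_div₀, map_pow, ratFuncHom_algebraMap,
    ratFuncHom_algebraMap, div_eq_mul_inv, ← inv_pow]
  have hmem := Subring.mul_mem _ (polyHomV_mem_supportedIn p a)
    (Subring.pow_mem _ (inv_polyHomV_mem_supportedIn_of_large p hf h) n)
  rw [slice_eq_zero, map_zero]
  intro e he hep
  have : 0 ≤ 1 * ofLex e p := hmem he
  omega

theorem formalRes_div_pow_of_small [CharZero K] (p : Fin (d + 1)) (a : (RatField K d)[X])
    {f : (RatField K d)[X]} (hf : f ≠ 0) (n : ℕ) (h : ∀ ρ, IsRootOf f ρ → IsSmall p ρ) :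
    formalRes p (ratFuncHom K p (algebraMap _ _ a / algebraMap _ _ f ^ n)) =
      insertHom K p (ratHom K d (-resInfty
        (algebraMap _ (RatFunc (RatField K d)) a / algebraMap _ _ f ^ n))) := by
  rw [formalRes_eq_insertHom_slice]
  congr 1
  have hfn : f ^ n ≠ 0 := pow_ne_zero n hf
  have hne : algebraMap (RatField K d)[X] (RatFunc (RatField K d)) (f ^ n) ≠ 0 :=
    RatFunc.algebraMap_ne_zero hfn
  rw [← map_pow]
  -- As 1/f has no positive powers of v, the exponents of v in a / f^n are at most deg a.
  refine slice_neg_one_eq_neg_resInfty p a hfn (N := a.natDegree) ?_ ?_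
  · rw [← ratFuncHom_algebraMap, ← map_mul, mul_div_cancel₀ _ hne,
      ratFuncHom_algebraMap]
  · intro k hk
    rw [map_pow, map_div₀, map_pow, ratFuncHom_algebraMap, ratFuncHom_algebraMap, div_eq_mul_inv,
      ← inv_pow]
    have hmem := Subring.mul_mem _ (polyHomV_mul_varPow_mem_supportedIn p a)
      (Subring.pow_mem _ (inv_polyHomV_mem_supportedIn_of_small p hf h) n)
    rw [show polyHomV K p a * (polyHomV K p f)⁻¹ ^ n = varPow K p a.natDegree *
        (polyHomV K p a * varPow K p (-a.natDegree) * (polyHomV K p f)⁻¹ ^ n) by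
      linear_combination (-polyHomV K p a * (polyHomV K p f)⁻¹ ^ n) *
        ((varPow_mul (K := K) p (a.natDegree : ℤ) (-a.natDegree)).trans
          (by rw [add_neg_cancel, varPow_zero])), slice_varPow_mul]
    refine slice_eq_zero fun e he hep => ?_
    have : 0 ≤ -1 * ofLex e p := hmem he
    omega

theorem formalRes_sum (p : Fin (d + 1)) {ι : Type*} (s : Finset ι)
    (F : ι → IterLaurent K (d + 1)) : formalRes p (∑ k ∈ s, F k) = ∑ k ∈ s, formalRes p (F k) := by
  simp only [formalRes_eq_insertHom_slice, map_sum]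

end Residue

end GeomRed

/-! ### The residue formula -/

theorem mainTheorem7 {K : Type*} [Field K] [CharZero K] (d : ℕ) (p : Fin (d + 1))
    (r : ℕ) (F : RatFunc (GeomRed.RatField K d))
    (a f : Fin r → Polynomial (GeomRed.RatField K d)) (n : Fin r → ℕ)
    (hf : ∀ k, Irreducible (f k))
    (hF : F = ∑ k, algebraMap _ (RatFunc (GeomRed.RatField K d)) (a k) /
      algebraMap _ (RatFunc (GeomRed.RatField K d)) (f k) ^ n k)
    (ε : Fin r → ℕ) (hε : ∀ k, ε k = 0 ∨ ε k = 1)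
    (hroots : ∀ k, ∀ ρ : GeomRed.QSeries K d, GeomRed.IsRootOf (f k) ρ →
      (ε k = 1 ↔ GeomRed.IsSmall p ρ)) :
    GeomRed.formalRes p (GeomRed.ratFuncHom K p F) =
        GeomRed.insertHom K p (GeomRed.ratHom K d
          (-∑ k, (ε k : GeomRed.RatField K d) * GeomRed.resInfty
            (algebraMap _ (RatFunc (GeomRed.RatField K d)) (a k) /
              algebraMap _ (RatFunc (GeomRed.RatField K d)) (f k) ^ n k))) ∧
      ∃ S : GeomRed.RatField K d,
        GeomRed.formalRes p (GeomRed.ratFuncHom K p F) =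
          GeomRed.insertHom K p (GeomRed.ratHom K d S) := by
  have key : GeomRed.formalRes p (GeomRed.ratFuncHom K p F) =
      GeomRed.insertHom K p (GeomRed.ratHom K d
        (-∑ k, (ε k : GeomRed.RatField K d) * GeomRed.resInfty
          (algebraMap _ (RatFunc (GeomRed.RatField K d)) (a k) /
            algebraMap _ (RatFunc (GeomRed.RatField K d)) (f k) ^ n k))) := by
    rw [hF, map_sum, GeomRed.formalRes_sum, ← Finset.sum_neg_distrib, map_sum, map_sum]
    refine Finset.sum_congr rfl fun k _ => ?_
    rcases hε k with h | h
    · rw [GeomRed.formalRes_div_pow_of_large p (a k) (hf k).ne_zero (n k), h, Nat.cast_zero,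
        zero_mul, neg_zero, map_zero, map_zero]
      intro ρ hρ hs
      have := (hroots k ρ hρ).2 hs
      omega
    · rw [GeomRed.formalRes_div_pow_of_small p (a k) (hf k).ne_zero (n k)
        fun ρ hρ => (hroots k ρ hρ).1 h, h, Nat.cast_one, one_mul]
  exact ⟨key, _, key⟩
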